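/- \textbf{Proposition.} Let $G$ be a graph of groups over a connected graph (loops and multiple edges allowed, not necessarily finite) with finite edge groups, let $\pi_1(G)$ be its fundamental group (taken with respect to any chosen spanning tree), and let $\widetilde G$ be its universal cover, that is, the Bass--Serre tree, regarded as a metric graph with edges of length one and with its natural action of $\pi_1(G)$. Let $v$ be a vertex of the underlying graph with vertex group $G_v$, let $w$ be the vertex of $\widetilde G$ over $v$ given by the trivial coset of $G_v$ (so $w$ is fixed by $G_v$), and suppose that $G_v$ acts by isometries on a non-empty complete CAT(0) space $X$. Then there is a complete CAT(0) space $Y$ on which $\pi_1(G)$ acts by isometries, such that: \begin{enumerate} \item $Y$ is obtained from $\widetilde G$ by blowing up each preimage $u$ of $v$ by a copy $X_u$ of $X$. That is, for each vertex $u$ of $\widetilde G$ over $v$ there is an isometric embedding of $X$ into $Y$ with image $X_u$, and the space obtained from $Y$ by collapsing each $X_u$ individually to a point, with the quotient metric, is isometric to $\widetilde G$ through an isometry $\Phi$ which takes the image of $X_u$ to $u$ for every $u$; \item the restriction to $G_v$ of the action on $Y$ preserves $X_w$, and the induced action on $X_w = X$ is the given action of $G_v$ on $X$; \item the action of $\pi_1(G)$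 permutes the copies, with $z\cdot X_u = X_{z\cdot u}$ for all $z \in \pi_1(G)$, so that it descends to the collapsed space, and the isometry $\Phi$ from the collapsed space onto $\widetilde G$ is $\pi_1(G)$-equivariant. \end{enumerate} -/

import Mathlib

open scoped ENNReal unitInterval

universe uV uE uG uH uX

/-! ## CAT(0) spaces -/

/-- `γ`, restricted to `[0, d(p,q)]`, is a geodesic from `p` to `q`. -/
def IsGeodesicFromTo {X : Type uX} [MetricSpace X] (γ : ℝ → X) (p q : X) : Prop :=
  γ 0 = p ∧ γ (dist p q) = q ∧
    ∀ s ∈ Set.Icc 0 (dist p q), ∀ t ∈ Set.Icc 0 (dist p q), dist (γ s) (γ t) = |s - t|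

/-- A metric space is CAT(0) if it is geodesic and every geodesic triangle is at least as thin as
its Euclidean comparison triangle. Two different sides of a triangle share a vertex, which is
called `p`; the points `γ s` and `δ t` range over the sides `[p, q]` and `[p, r]`, and `x'`, `y'`
are their comparison points in the comparison triangle `p' q' r'`. -/
structure IsCAT0 (X : Type uX) [MetricSpace X] : Prop where
  exists_geodesic : ∀ p q : X, ∃ γ : ℝ → X, IsGeodesicFromTo γ p q
  comparison : ∀ (p q r : X) (γ δ : ℝ → X),
    IsGeodesicFromTo γ p q → IsGeodesicFromTo δ p r →
    ∀ p' q' r' : EuclideanSpace ℝ (Fin 2),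
      dist p' q' = dist p q → dist p' r' = dist p r → dist q' r' = dist q r →
    ∀ s ∈ Set.Icc 0 (dist p q), ∀ t ∈ Set.Icc 0 (dist p r),
    ∀ x' y' : EuclideanSpace ℝ (Fin 2),
      dist p' x' = s → dist x' q' = dist p q - s →
      dist p' y' = t → dist y' r' = dist p r - t →
      dist (γ s) (δ t) ≤ dist x' y'

/-! ## Quotient metrics -/

/-- Finite chains of steps, with their total length. -/
inductive StepChain {Q : Type*} (step : Q → Q → ℝ≥0∞ → Prop) : Q → Q → ℝ≥0∞ → Prop
  | nil (x : Q) : StepChain step x x 0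
  | snoc {x y z : Q} {L l : ℝ≥0∞} :
      StepChain step x y L → step y z l → StepChain step x z (L + l)

namespace StepChain

variable {Q : Type*} {step : Q → Q → ℝ≥0∞ → Prop}

theorem append {x y z : Q} {L M : ℝ≥0∞} (h : StepChain step x y L) (k : StepChain step y z M) :
    StepChain step x z (L + M) := by
  induction k with
  | nil => simpa using h
  | snoc _ hs ih => rw [← add_assoc]; exact ih.snoc hs

theorem symm (hstep : ∀ x y l, step x y l → step y x l) {x y : Q} {L : ℝ≥0∞}
    (h : StepChain step x y L) : StepChain step y x L := by
  induction h with
  | nil => exact nil _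
  | snoc _ hs ih =>
    rw [add_comm]
    have h1 := (nil (step := step) _).snoc (hstep _ _ _ hs)
    rw [zero_add] at h1
    exact h1.append ih

end StepChain

/-- The pseudo-distance given by the infimum of the lengths of chains of steps (it is `∞` between
points which are not joined by a chain). -/
@[reducible] noncomputable def stepPseudoEMetricSpace {Q : Type*} (step : Q → Q → ℝ≥0∞ → Prop)
    (hstep : ∀ x y l, step x y l → step y x l) : PseudoEMetricSpace Q where
  edist x y := ⨅ (L : ℝ≥0∞) (_ : StepChain step x y L), L
  edist_self x := le_antisymm (iInf₂_le 0 (StepChain.nil x)) (zero_le)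
  edist_comm x y := le_antisymm
    (le_iInf₂ fun L h => iInf₂_le L (h.symm hstep))
    (le_iInf₂ fun L h => iInf₂_le L (h.symm hstep))
  edist_triangle x y z := by
    simp only [ENNReal.iInf_add, ENNReal.add_iInf]
    exact le_iInf₂ fun M k => le_iInf₂ fun L h => iInf₂_le (L + M) (h.append k)

/-- The space obtained from `Y` by collapsing each of the sets `A i` individually to a point. -/
def Collapse {Y : Type*} {ι : Type*} (A : ι → Set Y) : Type _ :=
  Quot fun y y' : Y => ∃ i, y ∈ A i ∧ y' ∈ A i

namespace Collapse

variable {Y : Type*} {ι : Type*} {A : ι → Set Y}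

/-- The collapsing map. -/
def mk (A : ι → Set Y) (y : Y) : Collapse A := Quot.mk _ y

/-- The collapsed space carries the quotient pseudo-metric: the infimum of
`d(a₀,b₀) + ⋯ + d(aₙ,bₙ)` over chains in which `bₖ` and `aₖ₊₁` are identified. -/
noncomputable instance [PseudoEMetricSpace Y] : PseudoEMetricSpace (Collapse A) :=
  stepPseudoEMetricSpace
    (fun p q l => ∃ y y' : Y, p = mk A y ∧ q = mk A y' ∧ l = edist y y')
    (by rintro _ _ _ ⟨y, y', rfl, rfl, rfl⟩; exact ⟨y', y, rfl, rfl, edist_comm _ _⟩)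

end Collapse

/-- `Y` is the blow-up of `T` at the points `pt i` by copies `emb i : X → Y` of `X`: each copy is
isometrically embedded, and collapsing each copy to a point yields a space isometric to `T`
(through `Φ`) in such a way that the `i`-th copy is collapsed onto `pt i`. -/
structure IsBlowUp {T X Y ι : Type*} [PseudoEMetricSpace T] [MetricSpace X] [MetricSpace Y]
    (pt : ι → T) (emb : ι → X → Y)
    (Φ : Collapse (fun i => Set.range (emb i)) ≃ᵢ T) : Prop where
  isometry : ∀ i, Isometry (emb i)
  collapse_eq : ∀ i x, Φ (Collapse.mk _ (emb i x)) = pt i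

/-! ## Graphs and their realisations -/

/-- A graph (loops and multiple edges are allowed), with an orientation of each edge. -/
structure OrientedGraph (V : Type uV) (E : Type uE) where
  src : E → V
  tgt : E → V

namespace OrientedGraph

variable {V : Type uV} {E : Type uE} (Γ : OrientedGraph V E)

/-- `u` and `w` are joined by a path of edges of `S`, crossed in either direction. -/
def Joined (S : Set E) : V → V → Prop :=
  Relation.EqvGen fun u w => ∃ e ∈ S, Γ.src e = u ∧ Γ.tgt e = w

/-- `S` is the edge set of a spanning tree: it connects all the vertices, and each of its edges
is a bridge of the graph `(V, S)`, that is, this graph has no cycles. -/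
structure IsSpanningTree (S : Set E) : Prop where
  joined : ∀ u w, Γ.Joined S u w
  bridge : ∀ e ∈ S, ¬ Γ.Joined (S \ {e}) (Γ.src e) (Γ.tgt e)

/-- The endpoints of the edge intervals are glued to the vertices. -/
inductive GlueRel : V ⊕ E × I → V ⊕ E × I → Prop
  | src (e : E) : GlueRel (Sum.inl (Γ.src e)) (Sum.inr (e, 0))
  | tgt (e : E) : GlueRel (Sum.inl (Γ.tgt e)) (Sum.inr (e, 1))

/-- The geometric realisation. -/
def Realization : Type _ := Quot Γ.GlueRel

/-- A vertex as a point of the realisation. -/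
def vertexPoint (u : V) : Γ.Realization := Quot.mk _ (Sum.inl u)

/-- The point at position `s` on the edge `e`. -/
def edgePoint (e : E) (s : I) : Γ.Realization := Quot.mk _ (Sum.inr (e, s))

/-- The path metric for which each edge has length one. -/
noncomputable instance : PseudoEMetricSpace Γ.Realization :=
  stepPseudoEMetricSpace
    (fun p q l => ∃ (e : E) (s t : I), p = Γ.edgePoint e s ∧ q = Γ.edgePoint e t ∧ l = edist s t)
    (by rintro _ _ _ ⟨e, s, t, rfl, rfl, rfl⟩; exact ⟨e, t, s, rfl, rfl, edist_comm _ _⟩)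

end OrientedGraph

/-! ## Graphs of groups -/

/-- A graph of groups over a connected graph: a group for each vertex and each edge, and
monomorphisms from each edge group to the groups of the two endpoints of the edge. -/
structure GraphOfGroups (V : Type uV) (E : Type uE) extends OrientedGraph V E where
  joined : ∀ u w, toOrientedGraph.Joined Set.univ u w
  vertexGroup : V → Type uG
  edgeGroup : E → Type uH
  [groupVertex : ∀ u, Group (vertexGroup u)]
  [groupEdge : ∀ e, Group (edgeGroup e)]
  srcHom : ∀ e, edgeGroup e →* vertexGroup (src e)
  tgtHom : ∀ e, edgeGroup e →* vertexGroup (tgt e)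
  srcHom_injective : ∀ e, Function.Injective (srcHom e)
  tgtHom_injective : ∀ e, Function.Injective (tgtHom e)

namespace GraphOfGroups

attribute [instance] groupVertex groupEdge

variable {V : Type uV} {E : Type uE} (G : GraphOfGroups.{uV, uE, uG, uH} V E) (S : Set E)

/-- The free product of all vertex groups and of the free group on the edges. -/
abbrev BigGroup : Type _ := Monoid.Coprod (Monoid.CoprodI G.vertexGroup) (FreeGroup E)

/-- The relations of the fundamental group:
`t_e * tgtHom e a * t_e⁻¹ = srcHom e a` for all edges `e`, and `t_e = 1` for `e` in `S`. -/
inductive Relator : G.BigGroup → Prop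
  | conj (e : E) (a : G.edgeGroup e) : Relator
      (Monoid.Coprod.inr (FreeGroup.of e) *
        Monoid.Coprod.inl (Monoid.CoprodI.of (G.tgtHom e a)) *
        (Monoid.Coprod.inr (FreeGroup.of e))⁻¹ *
        (Monoid.Coprod.inl (Monoid.CoprodI.of (G.srcHom e a)))⁻¹)
  | tree (e : E) (he : e ∈ S) : Relator (Monoid.Coprod.inr (FreeGroup.of e))

/-- The fundamental group of `G` relative to a spanning tree `S`. -/
abbrev FundamentalGroup : Type _ :=
  G.BigGroup ⧸ Subgroup.normalClosure {x | G.Relator S x}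

/-- The natural map from a vertex group to the fundamental group. -/
def vertexHom (u : V) : G.vertexGroup u →* G.FundamentalGroup S :=
  (QuotientGroup.mk' _).comp (Monoid.Coprod.inl.comp Monoid.CoprodI.of)

/-- The element of the fundamental group given by an edge. -/
def stableLetter (e : E) : G.FundamentalGroup S :=
  QuotientGroup.mk' _ (Monoid.Coprod.inr (FreeGroup.of e))

theorem stableLetter_conj (e : E) (a : G.edgeGroup e) :
    G.stableLetter S e * G.vertexHom S _ (G.tgtHom e a) * (G.stableLetter S e)⁻¹ =
      G.vertexHom S _ (G.srcHom e a) := by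
  rw [← mul_inv_eq_one]
  exact (QuotientGroup.eq_one_iff _).2 (Subgroup.subset_normalClosure (Relator.conj e a))

/-- The image of a vertex group in the fundamental group. -/
def vertexSubgroup (u : V) : Subgroup (G.FundamentalGroup S) := (G.vertexHom S u).range

/-- The image of an edge group in the fundamental group, through the source of the edge. -/
def edgeSubgroup (e : E) : Subgroup (G.FundamentalGroup S) :=
  ((G.vertexHom S (G.src e)).comp (G.srcHom e)).range

/-- Vertices of the Bass-Serre tree: cosets of the vertex groups. -/
abbrev TreeVertex : Type _ := Σ u : V, G.FundamentalGroup S ⧸ G.vertexSubgroup S u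

/-- Edges of the Bass-Serre tree: cosets of the edge groups. -/
abbrev TreeEdge : Type _ := Σ e : E, G.FundamentalGroup S ⧸ G.edgeSubgroup S e

/-- The Bass-Serre tree (the universal cover of `G`). The edge `g G_e` goes from `g G_(src e)` to
`g t_e G_(tgt e)`. -/
def bassSerreTree : OrientedGraph (G.TreeVertex S) (G.TreeEdge S) where
  src f := ⟨G.src f.1, Quotient.map' id (by
    intro a b h
    rw [QuotientGroup.leftRel_apply] at h ⊢
    obtain ⟨c, hc⟩ := h
    exact ⟨G.srcHom f.1 c, hc⟩) f.2⟩
  tgt f := ⟨G.tgt f.1, Quotient.map' (fun g => g * G.stableLetter S f.1) (by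
    intro a b h
    rw [QuotientGroup.leftRel_apply] at h ⊢
    obtain ⟨c, hc⟩ := h
    refine ⟨G.tgtHom f.1 c, ?_⟩
    have h1 := G.stableLetter_conj S f.1 c
    have h2 : G.vertexHom S _ (G.srcHom f.1 c) = a⁻¹ * b := hc
    rw [h2] at h1
    calc G.vertexHom S _ (G.tgtHom f.1 c)
        = (G.stableLetter S f.1)⁻¹ * (G.stableLetter S f.1 * G.vertexHom S _ (G.tgtHom f.1 c) *
            (G.stableLetter S f.1)⁻¹) * G.stableLetter S f.1 := by group
      _ = (a * G.stableLetter S f.1)⁻¹ * (b * G.stableLetter S f.1) := by rw [h1]; group) f.2⟩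

theorem bassSerreTree_src_smul (z : G.FundamentalGroup S) (f : G.TreeEdge S) :
    (G.bassSerreTree S).src (z • f) = z • (G.bassSerreTree S).src f := by
  obtain ⟨e, c⟩ := f
  induction c using Quotient.inductionOn'
  rfl

theorem bassSerreTree_tgt_smul (z : G.FundamentalGroup S) (f : G.TreeEdge S) :
    (G.bassSerreTree S).tgt (z • f) = z • (G.bassSerreTree S).tgt f := by
  obtain ⟨e, c⟩ := f
  induction c using Quotient.inductionOn' with
  | h g =>
    exact congrArg (Sigma.mk (G.tgt e)) (congrArg Quotient.mk'' (mul_assoc z g _))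

/-- The fundamental group acts on the realisation of the Bass-Serre tree by its left action on
the cosets. -/
instance : MulAction (G.FundamentalGroup S) (G.bassSerreTree S).Realization where
  smul z := Quot.map (Sum.map (fun u => z • u) (Prod.map (fun f => z • f) id)) (by
    rintro _ _ (f | f)
    · have h := OrientedGraph.GlueRel.src (Γ := G.bassSerreTree S) (z • f)
      rw [bassSerreTree_src_smul] at h
      exact h
    · have h := OrientedGraph.GlueRel.tgt (Γ := G.bassSerreTree S) (z • f)
      rw [bassSerreTree_tgt_smul] at h
      exact h)
  one_smul p := by
    induction p using Quot.ind with
    | mk p =>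
      refine congrArg (Quot.mk _) ?_
      rcases p with u | ⟨f, s⟩
      · exact congrArg Sum.inl (one_smul _ u)
      · exact congrArg (fun f => Sum.inr (f, s)) (one_smul _ f)
  mul_smul y z p := by
    induction p using Quot.ind with
    | mk p =>
      refine congrArg (Quot.mk _) ?_
      rcases p with u | ⟨f, s⟩
      · exact congrArg Sum.inl (mul_smul y z u)
      · exact congrArg (fun f => Sum.inr (f, s)) (mul_smul y z f)

/-- The lifts of `v` in the Bass-Serre tree, as points of its realisation. They are indexed by
the cosets of the vertex group. -/
def liftPoint (v : V) (u : G.FundamentalGroup S ⧸ G.vertexSubgroup S v) :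
    (G.bassSerreTree S).Realization :=
  (G.bassSerreTree S).vertexPoint ⟨v, u⟩

end GraphOfGroups

/-!
The proof separates metric geometry from Bass-Serre theory.

*CAT(0) geometry.* A geodesic space is CAT(0) if and only if Stewart's inequality bounds the distance
from a point `p` to a point `m` of a geodesic `[q, r]` (`IsCAT0.stewartAt`, `IsCAT0.of_stewartAt`;
the comparison of points on two sides of a triangle follows by using the inequality twice). In this
form the condition involves four points only and passes to a wedge of two spaces
(`IsWedge.stewartAt`). A tree of CAT(0) spaces glued at points is therefore CAT(0)
(`TreeOfSpaces.isCAT0_glued`): four points are in a finite subtree, which is an iterated wedge. That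
pieces are isometrically embedded and that gluing points separate follows from the 1-Lipschitz maps
which retract onto a piece or cut the tree at an edge.

*The space `Y`.* Over every lift of `v` there is a copy of `X`, over every other vertex of the
Bass-Serre tree a point, and every edge is a unit interval attached at its two ends. Completeness
(`TreeOfSpaces.completeSpace_glued`) uses that distinct vertex spaces are at distance at least one.
Collapsing the vertex spaces gives the realisation of the tree, because the quotient metric and the
metric of the tree are both defined by chains, and steps do not become longer in either direction
(`TreeOfSpaces.exists_collapse_isometryEquiv`).

*The action.* The copies of `X` form the induced space `π₁(G) ×_{G_v} X`. An interval is attached at a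
point `[g, x]` where `x` is fixed by the edge group; such a point exists since the edge group is finite
(`IsCAT0.exists_fixedPoint`), and the choice can be made equivariantly.

*Bass-Serre theory.* Two facts are needed: vertex groups embed in `π₁(G)`, and the Bass-Serre graph
is a tree. Both are obtained without normal forms, by mapping `π₁(G)` to a suitable group and using a
potential on the spanning tree (`OrientedGraph.IsSpanningTree.exists_potential`) to satisfy the
relations `t_e = 1`. For the embedding (`GraphOfGroups.vertexHom_injective`) the target is the group
of permutations of a large set on which all vertex groups act freely. For the tree property
(`GraphOfGroups.exists_edge_potential`) it is the semidirect product of `π₁(G)` with a module of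
functions on the edges; the homomorphism gives a function on the vertices whose difference along
each edge is the indicator function of that edge, so every edge is a bridge.
-/

/-! ### The CAT(0) condition as an inequality between distances -/

section Stewart

variable {Y : Type*} [MetricSpace Y]

/-- The inequality form of Stewart's theorem for a point `m` of a geodesic from `q` to `r`: the
distance from `p` to `m` is at most the distance in the Euclidean comparison triangle. That `m` is
on a geodesic is expressed by equality in the triangle inequality. -/
def StewartAt (p q m r : Y) : Prop :=
  dist q m + dist m r = dist q r →
    dist p m ^ 2 * dist q r ≤
      dist p q ^ 2 * dist m r + dist p r ^ 2 * dist q m - dist q m * dist m r * dist q r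

theorem StewartAt.symm {p q m r : Y} (h : StewartAt p q m r) : StewartAt p r m q := by
  intro h1
  have h2 := h (by rw [dist_comm q m, dist_comm m r, dist_comm q r]; linarith)
  rw [dist_comm r m, dist_comm m q, dist_comm r q]
  linarith

/-- Two consecutive geodesics can be concatenated if their lengths add up to the distance between
the outer endpoints. -/
theorem IsGeodesicFromTo.concat {γ δ : ℝ → Y} {q m r : Y} (hγ : IsGeodesicFromTo γ q m)
    (hδ : IsGeodesicFromTo δ m r) (h : dist q m + dist m r = dist q r) :
    ∃ η : ℝ → Y, IsGeodesicFromTo η q r ∧ η (dist q m) = m := by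
  obtain ⟨hγ0, hγ1, hγ2⟩ := hγ
  obtain ⟨hδ0, hδ1, hδ2⟩ := hδ
  have hqm := dist_nonneg (x := q) (y := m)
  have hmr := dist_nonneg (x := m) (y := r)
  have key : ∀ s ∈ Set.Icc 0 (dist q m), ∀ t ∈ Set.Icc 0 (dist m r),
      dist (γ s) (δ t) = dist q m + t - s := by
    intro s hs t ht
    have h1 := hγ2 0 ⟨le_rfl, hqm⟩ s hs
    have h2 := hγ2 s hs _ ⟨hqm, le_rfl⟩
    have h3 := hδ2 0 ⟨le_rfl, hmr⟩ t ht
    have h4 := hδ2 t ht _ ⟨hmr, le_rfl⟩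
    rw [hγ0, abs_sub_comm, sub_zero, abs_of_nonneg hs.1] at h1
    rw [hγ1, abs_sub_comm, abs_of_nonneg (sub_nonneg.2 hs.2)] at h2
    rw [hδ0, abs_sub_comm, sub_zero, abs_of_nonneg ht.1] at h3
    rw [hδ1, abs_sub_comm, abs_of_nonneg (sub_nonneg.2 ht.2)] at h4
    have h5 := dist_triangle (γ s) m (δ t)
    have h6 := dist_triangle4 q (γ s) (δ t) r
    linarith
  have e1 : ∀ s, s ≤ dist q m → (if s ≤ dist q m then γ s else δ (s - dist q m)) = γ s :=
    fun s hs => if_pos hs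
  have e2 : ∀ s, dist q m ≤ s → (if s ≤ dist q m then γ s else δ (s - dist q m))
      = δ (s - dist q m) := by
    intro s hs
    split_ifs with h1
    · have h2 : s = dist q m := le_antisymm h1 hs
      rw [h2, hγ1, sub_self, hδ0]
    · rfl
  refine ⟨fun s => if s ≤ dist q m then γ s else δ (s - dist q m), ⟨?_, ?_, ?_⟩, ?_⟩
  · exact (e1 0 hqm).trans hγ0
  · refine (e2 _ (by linarith)).trans ?_
    rw [← h, add_sub_cancel_left, hδ1]
  · have main : ∀ s ∈ Set.Icc 0 (dist q r), ∀ t ∈ Set.Icc 0 (dist q r), s ≤ t →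
        dist (if s ≤ dist q m then γ s else δ (s - dist q m))
          (if t ≤ dist q m then γ t else δ (t - dist q m)) = |s - t| := by
      intro s hs t ht hst
      rcases le_total t (dist q m) with h1 | h1
      · rw [e1 s (hst.trans h1), e1 t h1]
        exact hγ2 s ⟨hs.1, hst.trans h1⟩ t ⟨ht.1, h1⟩
      · rw [e2 t h1]
        have ht' : t - dist q m ∈ Set.Icc 0 (dist m r) := ⟨by linarith, by linarith [ht.2]⟩
        rcases le_total s (dist q m) with h2 | h2
        · rw [e1 s h2, key s ⟨hs.1, h2⟩ _ ht', abs_sub_comm, abs_of_nonneg (by linarith)]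
          ring
        · rw [e2 s h2, hδ2 _ ⟨by linarith, by linarith [ht'.2]⟩ _ ht']
          congr 1
          ring
    intro s hs t ht
    rcases le_total s t with h1 | h1
    · exact main s hs t ht h1
    · rw [dist_comm, abs_sub_comm]
      exact main t ht s hs h1
  · exact (e1 _ le_rfl).trans hγ1

/-- Stewart's theorem in a real inner product space. -/
theorem stewart_of_inner {F : Type*} [NormedAddCommGroup F] [InnerProductSpace ℝ F] {p q m r : F}
    (h : dist q m + dist m r = dist q r) :
    dist p m ^ 2 * dist q r =
      dist p q ^ 2 * dist m r + dist p r ^ 2 * dist q m - dist q m * dist m r * dist q r := by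
  obtain ⟨t, ht, rfl⟩ := dist_add_dist_eq_iff.1 h
  have h1 : dist q (AffineMap.lineMap q r t) = t * dist q r := by
    rw [dist_left_lineMap, Real.norm_of_nonneg ht.1]
  have h2 : dist (AffineMap.lineMap q r t) r = (1 - t) * dist q r := by
    rw [dist_lineMap_right, Real.norm_of_nonneg (sub_nonneg.2 ht.2)]
  have h3 : dist p (AffineMap.lineMap q r t) ^ 2 =
      (1 - t) * dist p q ^ 2 + t * dist p r ^ 2 - t * (1 - t) * dist q r ^ 2 := by
    have e1 : p - AffineMap.lineMap q r t = (1 - t) • (p - q) + t • (p - r) := by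
      rw [AffineMap.lineMap_apply_module]
      module
    have e2 : q - r = (p - r) - (p - q) := by abel
    rw [dist_eq_norm, dist_eq_norm, dist_eq_norm, dist_eq_norm, e1, e2, norm_add_sq_real,
      norm_sub_sq_real (p - r) (p - q), norm_smul, norm_smul, real_inner_smul_left,
      real_inner_smul_right, mul_pow, mul_pow, real_inner_comm (p - r) (p - q), Real.norm_eq_abs, Real.norm_eq_abs,
      sq_abs, sq_abs]
    ring
  rw [h1, h2, h3]
  ring

/-- There is a Euclidean triangle with prescribed side lengths. -/
theorem exists_comparison_triangle {a b c : ℝ} (ha : 0 ≤ a) (hb : 0 ≤ b) (hc : 0 ≤ c)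
    (h1 : a ≤ b + c) (h2 : b ≤ a + c) (h3 : c ≤ a + b) :
    ∃ p q r : EuclideanSpace ℝ (Fin 2), dist p q = a ∧ dist p r = b ∧ dist q r = c := by
  rcases ha.eq_or_lt with rfl | ha'
  · refine ⟨!₂[0, 0], !₂[0, 0], !₂[b, 0], ?_, ?_, ?_⟩
    · simp
    · simp [EuclideanSpace.dist_eq, Fin.sum_univ_two, Real.sqrt_sq_eq_abs, abs_of_nonneg hb]
    · have : b = c := by linarith
      simp [EuclideanSpace.dist_eq, Fin.sum_univ_two, Real.sqrt_sq_eq_abs, abs_of_nonneg hc, this]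
  · -- the foot of the altitude from `r` is at distance `x` from `p`
    set x := (a ^ 2 + b ^ 2 - c ^ 2) / (2 * a) with hx
    have hxa : x * (2 * a) = a ^ 2 + b ^ 2 - c ^ 2 := by
      rw [hx]; field_simp
    have hxb : x ^ 2 ≤ b ^ 2 := by
      rw [sq_le_sq, abs_of_nonneg hb, abs_le]
      constructor
      · rw [hx, le_div_iff₀ (by positivity)]
        nlinarith
      · rw [hx, div_le_iff₀ (by positivity)]
        nlinarith
    have hy : Real.sqrt (b ^ 2 - x ^ 2) ^ 2 = b ^ 2 - x ^ 2 := Real.sq_sqrt (by linarith)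
    refine ⟨!₂[0, 0], !₂[a, 0], !₂[x, Real.sqrt (b ^ 2 - x ^ 2)], ?_, ?_, ?_⟩
    · simp [EuclideanSpace.dist_eq, Fin.sum_univ_two, Real.sqrt_sq_eq_abs, abs_of_nonneg ha]
    · rw [EuclideanSpace.dist_eq, Real.sqrt_eq_iff_mul_self_eq (by positivity) hb]
      simp [Fin.sum_univ_two, Real.dist_eq, hy]
      ring
    · rw [EuclideanSpace.dist_eq, Real.sqrt_eq_iff_mul_self_eq (by positivity) hc]
      simp [Fin.sum_univ_two, Real.dist_eq, hy]
      nlinarith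

theorem IsCAT0.stewartAt (hY : IsCAT0 Y) (p q m r : Y) : StewartAt p q m r := by
  intro h
  obtain ⟨γ₁, hγ₁⟩ := hY.exists_geodesic q m
  obtain ⟨γ₂, hγ₂⟩ := hY.exists_geodesic m r
  obtain ⟨γ, hγ, hγm⟩ := hγ₁.concat hγ₂ h
  obtain ⟨δ, hδ⟩ := hY.exists_geodesic q p
  obtain ⟨q', r', p', h1, h2, h3⟩ := exists_comparison_triangle (dist_nonneg (x := q) (y := r))
    (dist_nonneg (x := q) (y := p)) (dist_nonneg (x := r) (y := p))
    (by rw [dist_comm r p]; exact dist_triangle _ _ _) (dist_triangle _ _ _)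
    (by rw [dist_comm q r]; exact dist_triangle _ _ _)
  have hqm := dist_nonneg (x := q) (y := m)
  have hmr := dist_nonneg (x := m) (y := r)
  obtain ⟨m', hm1, hm2⟩ : ∃ m' : EuclideanSpace ℝ (Fin 2),
      dist q' m' = dist q m ∧ dist m' r' = dist q r - dist q m := by
    rcases (dist_nonneg (x := q) (y := r)).eq_or_lt with h0 | h0
    · refine ⟨q', ?_, ?_⟩
      · rw [dist_self]; linarith
      · rw [h1]; linarith
    · refine ⟨AffineMap.lineMap q' r' (dist q m / dist q r), ?_, ?_⟩
      · rw [dist_left_lineMap, h1, Real.norm_of_nonneg (by positivity)]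
        field_simp
      · have : 0 ≤ 1 - dist q m / dist q r := by
          rw [sub_nonneg, div_le_one h0]
          linarith
        rw [dist_lineMap_right, h1, Real.norm_of_nonneg this]
        field_simp
  have key := hY.comparison q r p γ δ hγ hδ q' r' p' h1 h2 h3 (dist q m) ⟨hqm, by linarith⟩
    (dist q p) ⟨dist_nonneg, le_rfl⟩ m' p' hm1 hm2 h2 (by simp)
  rw [hγm, hδ.2.1, dist_comm m p, dist_comm m' p'] at key
  have h4 : dist m' r' = dist m r := by linarith
  have st := stewart_of_inner (p := p') (q := q') (m := m') (r := r') (by rw [hm1, hm2, h1]; ring)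
  rw [hm1, h4, h1, dist_comm p' q', h2, dist_comm p' r', h3, dist_comm q p, dist_comm r p] at st
  rw [← st]
  gcongr

/-- The comparison of a point of one side with the opposite vertex, given by Stewart's inequality,
implies the comparison of two points on two sides: apply it twice. -/
theorem IsCAT0.of_stewartAt (hgeo : ∀ p q : Y, ∃ γ : ℝ → Y, IsGeodesicFromTo γ p q)
    (hst : ∀ p q m r : Y, StewartAt p q m r) : IsCAT0 Y where
  exists_geodesic := hgeo
  comparison := by
    intro p q r γ δ hγ hδ p' q' r' hpq hpr hqr s hs t ht x' y' hx1 hx2 hy1 hy2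
    have hP := dist_nonneg (x := p) (y := q)
    have hR := dist_nonneg (x := p) (y := r)
    have gx1 : dist p (γ s) = s := by
      have := hγ.2.2 0 ⟨le_rfl, hP⟩ s hs
      rwa [hγ.1, abs_sub_comm, sub_zero, abs_of_nonneg hs.1] at this
    have gx2 : dist (γ s) q = dist p q - s := by
      have := hγ.2.2 s hs _ ⟨hP, le_rfl⟩
      rwa [hγ.2.1, abs_sub_comm, abs_of_nonneg (sub_nonneg.2 hs.2)] at this
    have gy1 : dist p (δ t) = t := by
      have := hδ.2.2 0 ⟨le_rfl, hR⟩ t ht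
      rwa [hδ.1, abs_sub_comm, sub_zero, abs_of_nonneg ht.1] at this
    have gy2 : dist (δ t) r = dist p r - t := by
      have := hδ.2.2 t ht _ ⟨hR, le_rfl⟩
      rwa [hδ.2.1, abs_sub_comm, abs_of_nonneg (sub_nonneg.2 ht.2)] at this
    rcases hP.eq_or_lt with hP0 | hP0
    · have hs0 : s = 0 := le_antisymm (by linarith [hs.2]) hs.1
      rw [hs0] at hx1
      rw [hs0, hγ.1, gy1, ← dist_eq_zero.1 hx1, hy1]
    rcases hR.eq_or_lt with hR0 | hR0
    · have ht0 : t = 0 := le_antisymm (by linarith [ht.2]) ht.1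
      rw [ht0] at hy1
      rw [ht0, hδ.1, dist_comm, gx1, ← dist_eq_zero.1 hy1, dist_comm, hx1]
    have a1 := hst (δ t) p (γ s) q (by rw [gx1, gx2]; ring)
    have a2 := hst q p (δ t) r (by rw [gy1, gy2]; ring)
    have b1 := stewart_of_inner (p := y') (q := p') (m := x') (r := q')
      (by rw [hx1, hx2, hpq]; ring)
    have b2 := stewart_of_inner (p := q') (q := p') (m := y') (r := r')
      (by rw [hy1, hy2, hpr]; ring)
    rw [dist_comm (δ t) p, dist_comm (δ t) q, gx1, gx2, gy1, dist_comm (δ t)] at a1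
    rw [dist_comm q p, gy1, gy2] at a2
    rw [dist_comm y' p', dist_comm y' q', hx1, hx2, hy1, hpq, dist_comm y'] at b1
    rw [dist_comm q' p', hy1, hy2, hpq, hpr, hqr] at b2
    have c1 : dist q (δ t) ^ 2 ≤ dist q' y' ^ 2 := le_of_mul_le_mul_right (by linarith) hR0
    have c2 : dist (γ s) (δ t) ^ 2 ≤ dist x' y' ^ 2 := by
      refine le_of_mul_le_mul_right ?_ hP0
      have := mul_le_mul_of_nonneg_right c1 hs.1
      linarith
    exact (sq_le_sq₀ dist_nonneg dist_nonneg).1 c2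

/-- The CAT(0) condition is inherited along a bijective isometry. -/
theorem IsCAT0.of_isometry {Z : Type*} [MetricSpace Z] (hY : IsCAT0 Y) {f : Y → Z}
    (hf : Isometry f) (hs : Function.Surjective f) : IsCAT0 Z := by
  refine .of_stewartAt (fun p q => ?_) (fun p q m r => ?_)
  · obtain ⟨p, rfl⟩ := hs p
    obtain ⟨q, rfl⟩ := hs q
    obtain ⟨γ, h0, h1, h2⟩ := hY.exists_geodesic p q
    refine ⟨f ∘ γ, by simp [h0], by simp [hf.dist_eq, h1], ?_⟩
    simpa [hf.dist_eq] using h2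
  · obtain ⟨p, rfl⟩ := hs p
    obtain ⟨q, rfl⟩ := hs q
    obtain ⟨m, rfl⟩ := hs m
    obtain ⟨r, rfl⟩ := hs r
    have := hY.stewartAt p q m r
    simpa [StewartAt, hf.dist_eq] using this

theorem IsCAT0.of_subsingleton [Subsingleton Y] : IsCAT0 Y := by
  refine .of_stewartAt (fun p q => ?_) (fun p q m r => ?_)
  · obtain rfl := Subsingleton.elim p q
    refine ⟨fun _ => p, rfl, rfl, fun s hs t ht => ?_⟩
    simp only [dist_self, Set.Icc_self, Set.mem_singleton_iff] at hs ht ⊢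
    simp [hs, ht]
  · intro _
    simp [Subsingleton.elim m p, Subsingleton.elim q p, Subsingleton.elim r p]

theorem isCAT0_unitInterval : IsCAT0 I := by
  refine .of_stewartAt (fun p q => ?_) (fun p q m r h => ?_)
  · rcases le_total p q with h | h
    · have hd : dist p q = q - p := by
        rw [Subtype.dist_eq, dist_comm, Real.dist_eq,
          abs_of_nonneg (sub_nonneg.2 (Subtype.coe_le_coe.2 h))]
      have hm : ∀ s ∈ Set.Icc 0 (dist p q), (p : ℝ) + s ∈ I := fun s hs =>
        ⟨add_nonneg p.2.1 hs.1, by linarith [hs.2, q.2.2]⟩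
      refine ⟨fun s => Set.projIcc 0 1 zero_le_one (p + s), ?_, ?_, fun s hs t ht => ?_⟩
      · simp
      · simp [hd]
      · dsimp only
        rw [Set.projIcc_of_mem _ (hm s hs), Set.projIcc_of_mem _ (hm t ht), Subtype.dist_eq,
          Real.dist_eq]
        congr 1
        ring
    · have hd : dist p q = p - q := by
        rw [Subtype.dist_eq, Real.dist_eq, abs_of_nonneg (sub_nonneg.2 (Subtype.coe_le_coe.2 h))]
      have hm : ∀ s ∈ Set.Icc 0 (dist p q), (p : ℝ) - s ∈ I := fun s hs =>
        ⟨by linarith [hs.2, q.2.1], by linarith [hs.1, p.2.2]⟩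
      refine ⟨fun s => Set.projIcc 0 1 zero_le_one (p - s), ?_, ?_, fun s hs t ht => ?_⟩
      · simp
      · simp [hd]
      · dsimp only
        rw [Set.projIcc_of_mem _ (hm s hs), Set.projIcc_of_mem _ (hm t ht), Subtype.dist_eq,
          Real.dist_eq, abs_sub_comm]
        congr 1
        ring
  · simp only [Subtype.dist_eq] at h ⊢
    exact (stewart_of_inner h).le

end Stewart

/-! ### Wedges of two CAT(0) spaces -/

section Wedge

variable {Y : Type*} [MetricSpace Y]

/-- Every point of `A` is joined to every point of `B` through `o`. -/
def IsWedge (A B : Set Y) (o : Y) : Prop :=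
  ∀ a ∈ A, ∀ b ∈ B, dist a b = dist a o + dist o b

theorem IsWedge.symm {A B : Set Y} {o : Y} (h : IsWedge A B o) : IsWedge B A o := by
  intro b hb a ha
  rw [dist_comm b a, h a ha b hb, dist_comm a o, dist_comm o b, add_comm]

/-- If the vertex `p` is in one of two spaces with a common point `o` and the opposite side is in
the other, then adding the constant `d(p, o)` to all distances from `o` preserves Stewart's
inequality, because the distance from `o` is convex. -/
theorem IsWedge.stewartAt_vertex {A B : Set Y} {o p q m r : Y} (h : IsWedge A B o) (hp : p ∈ A)
    (hq : q ∈ B) (hm : m ∈ B) (hr : r ∈ B) (hst : StewartAt o q m r) : StewartAt p q m r := by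
  intro hd
  have h1 := hst hd
  rw [h p hp q hq, h p hp m hm, h p hp r hr]
  have h2 := dist_triangle_left q r o
  have h3 := dist_triangle o q r
  have h4 := dist_triangle_right o q r
  have hD := dist_nonneg (x := p) (y := o)
  have ha := dist_nonneg (x := q) (y := m)
  have hb := dist_nonneg (x := m) (y := r)
  have hoq := dist_nonneg (x := o) (y := q)
  have hom := dist_nonneg (x := o) (y := m)
  have hor := dist_nonneg (x := o) (y := r)
  rw [← hd] at h1 h2 h3 h4 ⊢
  generalize dist p o = D at *
  generalize dist q m = a at *
  generalize dist m r = b at *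
  generalize dist o q = Q at *
  generalize dist o m = M at *
  generalize dist o r = R at *
  -- the distance from `o` is convex along the geodesic
  have hconv : M * (a + b) ≤ Q * b + R * a := by
    have h5 : (M * (a + b)) ^ 2 ≤ (Q * b + R * a) ^ 2 := by
      have h6 : (Q - R) ^ 2 ≤ (a + b) ^ 2 := by
        rw [sq_le_sq, abs_of_nonneg (a := a + b) (by linarith), abs_le]
        constructor <;> linarith
      have h7 := mul_le_mul_of_nonneg_left h6 (mul_nonneg ha hb)
      have h8 := mul_le_mul_of_nonneg_right h1 (add_nonneg ha hb)
      nlinarith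
    exact (sq_le_sq₀ (by positivity) (by positivity)).1 h5
  have := mul_le_mul_of_nonneg_left hconv hD
  nlinarith

/-- Stewart's inequality for a geodesic which ends at `o` implies the one for its extension beyond
`o`, away from `p`. -/
theorem IsWedge.stewartAt_end {A B : Set Y} {o p q m r : Y} (h : IsWedge A B o) (hp : p ∈ A)
    (hq : q ∈ A) (hm : m ∈ A) (hr : r ∈ B) (hst : StewartAt p q m o) : StewartAt p q m r := by
  intro hd
  rw [h q hq r hr, h m hm r hr] at hd ⊢
  rw [h p hp r hr]
  have hd' : dist q m + dist m o = dist q o := by linarith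
  have h1 := hst hd'
  have h2 := dist_triangle_left q o p
  have h3 := dist_triangle p q o
  have h4 := dist_triangle_right p q o
  have ha := dist_nonneg (x := q) (y := m)
  have hb := dist_nonneg (x := m) (y := o)
  have hc := dist_nonneg (x := o) (y := r)
  rcases (dist_nonneg (x := q) (y := o)).eq_or_lt with h0 | h0
  · have hqm : q = m := dist_eq_zero.1 (by linarith)
    subst hqm
    rw [dist_self]
    have : dist q o = 0 := h0.symm
    rw [this]
    linarith
  rw [← hd'] at h0 h1 h2 h3 h4 ⊢
  generalize dist q m = a at *
  generalize dist m o = b at *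
  generalize dist o r = c at *
  generalize dist p q = Q at *
  generalize dist p o = D at *
  generalize dist p m = M at *
  have h5 : (a + b - D) ^ 2 ≤ Q ^ 2 := by
    rw [sq_le_sq, abs_of_nonneg (a := Q) (by linarith), abs_le]
    constructor <;> linarith
  refine le_of_mul_le_mul_right ?_ h0
  have h6 := mul_le_mul_of_nonneg_right h1 (add_nonneg h0.le hc)
  have h7 := mul_le_mul_of_nonneg_left h5 (mul_nonneg ha hc)
  nlinarith

/-- Beyond `o` the distance from `p` grows at unit speed, so that only the triangle inequality for
`p`, `q` and `o` is needed. -/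
theorem IsWedge.stewartAt_far {A B : Set Y} {o p q m r : Y} (h : IsWedge A B o) (hp : p ∈ A)
    (hq : q ∈ A) (hm : m ∈ B) (hr : r ∈ B) : StewartAt p q m r := by
  intro hd
  rw [h q hq r hr, h q hq m hm] at hd ⊢
  rw [h p hp r hr, h p hp m hm]
  have h2 := dist_triangle_left q o p
  have h3 := dist_triangle p q o
  have h4 := dist_triangle_right p q o
  have ha := dist_nonneg (x := o) (y := m)
  have hb := dist_nonneg (x := m) (y := r)
  have hor : dist o r = dist o m + dist m r := by linarith
  rw [hor]
  generalize dist q o = L at *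
  generalize dist o m = a at *
  generalize dist m r = b at *
  generalize dist p q = Q at *
  generalize dist p o = D at *
  have h5 : (L - D) ^ 2 ≤ Q ^ 2 := by
    rw [sq_le_sq, abs_of_nonneg (a := Q) (by linarith), abs_le]
    constructor <;> linarith
  have h6 := mul_le_mul_of_nonneg_right h5 hb
  nlinarith

/-- A geodesic between two points of one half of a wedge does not enter the other half. -/
theorem IsWedge.eq_of_between {A B : Set Y} {o q m r : Y} (h : IsWedge A B o) (hq : q ∈ A)
    (hm : m ∈ B) (hr : r ∈ A) (hd : dist q m + dist m r = dist q r) : m = o := by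
  rw [h q hq m hm, h.symm m hm r hr] at hd
  have h1 := dist_triangle q o r
  have h2 := dist_comm m o
  have h3 := dist_nonneg (x := m) (y := o)
  exact dist_eq_zero.1 (by linarith)

/-- Stewart's inequality passes to a wedge. -/
theorem IsWedge.stewartAt {A B : Set Y} {o : Y} (h : IsWedge A B o) (hoA : o ∈ A) (hoB : o ∈ B)
    (hA : ∀ p ∈ A, ∀ q ∈ A, ∀ m ∈ A, ∀ r ∈ A, StewartAt p q m r)
    (hB : ∀ p ∈ B, ∀ q ∈ B, ∀ m ∈ B, ∀ r ∈ B, StewartAt p q m r) :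
    ∀ p ∈ A ∪ B, ∀ q ∈ A ∪ B, ∀ m ∈ A ∪ B, ∀ r ∈ A ∪ B, StewartAt p q m r := by
  have main : ∀ {A B : Set Y}, IsWedge A B o → o ∈ A → o ∈ B →
      (∀ p ∈ A, ∀ q ∈ A, ∀ m ∈ A, ∀ r ∈ A, StewartAt p q m r) →
      (∀ p ∈ B, ∀ q ∈ B, ∀ m ∈ B, ∀ r ∈ B, StewartAt p q m r) →
      ∀ p ∈ A, ∀ q ∈ A ∪ B, ∀ m ∈ A ∪ B, ∀ r ∈ A ∪ B, StewartAt p q m r := by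
    intro A B h hoA hoB hA hB p hp q hq m hm r hr
    rcases hq with hq | hq <;> rcases hm with hm | hm <;> rcases hr with hr | hr
    · exact hA p hp q hq m hm r hr
    · exact h.stewartAt_end hp hq hm hr (hA p hp q hq m hm o hoA)
    · intro hd
      have := h.eq_of_between hq hm hr hd
      subst this
      exact hA p hp q hq m hoA r hr hd
    · exact h.stewartAt_far hp hq hm hr
    · exact (h.stewartAt_end hp hr hm hq (hA p hp r hr m hm o hoA)).symm
    · intro hd
      have := h.symm.eq_of_between hq hm hr hd
      subst this
      exact h.stewartAt_vertex hp hq hoB hr (hB m hoB q hq m hoB r hr) hd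
    · exact (h.stewartAt_far hp hr hm hq).symm
    · exact h.stewartAt_vertex hp hq hm hr (hB o hoB q hq m hm r hr)
  intro p hp q hq m hm r hr
  rcases hp with hp | hp
  · exact main h hoA hoB hA hB p hp q hq m hm r hr
  · rw [Set.union_comm] at hq hm hr
    exact main h.symm hoB hoA hB hA p hp q hq m hm r hr

/-- Geodesics exist in a wedge. -/
theorem IsWedge.exists_geodesic {A B : Set Y} {o : Y} (h : IsWedge A B o) (hoA : o ∈ A)
    (hoB : o ∈ B) (hA : ∀ p ∈ A, ∀ q ∈ A, ∃ γ : ℝ → Y, IsGeodesicFromTo γ p q)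
    (hB : ∀ p ∈ B, ∀ q ∈ B, ∃ γ : ℝ → Y, IsGeodesicFromTo γ p q) :
    ∀ p ∈ A ∪ B, ∀ q ∈ A ∪ B, ∃ γ : ℝ → Y, IsGeodesicFromTo γ p q := by
  rintro p (hp | hp) q (hq | hq)
  · exact hA p hp q hq
  · obtain ⟨γ, hγ⟩ := hA p hp o hoA
    obtain ⟨δ, hδ⟩ := hB o hoB q hq
    obtain ⟨η, hη, -⟩ := hγ.concat hδ (h p hp q hq).symm
    exact ⟨η, hη⟩
  · obtain ⟨γ, hγ⟩ := hB p hp o hoB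
    obtain ⟨δ, hδ⟩ := hA o hoA q hq
    obtain ⟨η, hη, -⟩ := hγ.concat hδ (h.symm p hp q hq).symm
    exact ⟨η, hη⟩
  · exact hB p hp q hq

end Wedge

/-! ### Fixed points of finite groups -/

/-- A finite group acting by isometries on a complete CAT(0) space fixes a point. The sum of the
squared distances to the points of an orbit is an invariant function, and by Stewart's inequality
for midpoints it is so convex that it has a unique minimum. -/
theorem IsCAT0.exists_fixedPoint {X : Type*} [MetricSpace X] [Nonempty X] [CompleteSpace X]
    (hX : IsCAT0 X) {H : Type*} [Group H] [Finite H] (φ : H →* Equiv.Perm X)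
    (hφ : ∀ h x y, dist (φ h x) (φ h y) = dist x y) : ∃ x : X, ∀ h, φ h x = x := by
  have := Fintype.ofFinite H
  obtain ⟨x₀⟩ := ‹Nonempty X›
  set f : X → ℝ := fun x => ∑ h : H, dist (φ h x₀) x ^ 2 with hf
  have hf0 : ∀ x, 0 ≤ f x := fun x => Finset.sum_nonneg fun h _ => sq_nonneg _
  have hinv : ∀ g x, f (φ g x) = f x := by
    intro g x
    rw [hf]
    dsimp only
    rw [← Equiv.sum_comp (Equiv.mulLeft g)]
    refine Finset.sum_congr rfl fun h _ => ?_
    rw [Equiv.coe_mulLeft, map_mul, Equiv.Perm.mul_apply, hφ]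
  have hcont : Continuous f := by
    rw [hf]
    fun_prop
  set i := ⨅ x, f x with hi
  have hbdd : BddBelow (Set.range f) := ⟨0, by rintro _ ⟨x, rfl⟩; exact hf0 x⟩
  have hle : ∀ x, i ≤ f x := fun x => ciInf_le hbdd x
  -- two points where `f` is almost minimal are close together, as `f` is too small at the midpoint
  -- otherwise
  have hconv : ∀ x y, dist x y ^ 2 ≤ 2 * (f x - i) + 2 * (f y - i) := by
    intro x y
    obtain ⟨γ, h0, h1, h2⟩ := hX.exists_geodesic x y
    have hd := dist_nonneg (x := x) (y := y)
    have hmid : dist x y / 2 ∈ Set.Icc 0 (dist x y) := ⟨by linarith, by linarith⟩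
    set m := γ (dist x y / 2) with hm
    have hxm : dist x m = dist x y / 2 := by
      have := h2 0 ⟨le_rfl, hd⟩ _ hmid
      rwa [h0, abs_sub_comm, sub_zero, abs_of_nonneg hmid.1] at this
    have hmy : dist m y = dist x y / 2 := by
      have := h2 _ hmid _ ⟨hd, le_rfl⟩
      rw [h1, abs_sub_comm, abs_of_nonneg (by linarith)] at this
      rw [hm, this]
      ring
    have hst : ∀ p, dist p m ^ 2 ≤ dist p x ^ 2 / 2 + dist p y ^ 2 / 2 - dist x y ^ 2 / 4 := by
      intro p
      rcases hd.eq_or_lt with h3 | h3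
      · have e1 : x = m := dist_eq_zero.1 (by rw [hxm, ← h3]; simp)
        have e2 : x = y := dist_eq_zero.1 h3.symm
        rw [← e1, ← e2, dist_self]
        linarith
      · have := hX.stewartAt p x m y (by rw [hxm, hmy]; ring)
        rw [hxm, hmy] at this
        refine le_of_mul_le_mul_right ?_ h3
        linarith
    have hsum : f m ≤ f x / 2 + f y / 2 - dist x y ^ 2 / 4 := by
      have h4 : f m ≤ ∑ h : H, (dist (φ h x₀) x ^ 2 / 2 + dist (φ h x₀) y ^ 2 / 2
          - dist x y ^ 2 / 4) := Finset.sum_le_sum fun h _ => hst _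
      rw [Finset.sum_sub_distrib, Finset.sum_add_distrib, ← Finset.sum_div, ← Finset.sum_div,
        Finset.sum_const, nsmul_eq_mul] at h4
      have h5 : (1 : ℝ) ≤ (Finset.univ : Finset H).card := by
        exact_mod_cast Finset.card_pos.2 ⟨1, Finset.mem_univ _⟩
      have h6 := mul_le_mul_of_nonneg_right h5 (by positivity : 0 ≤ dist x y ^ 2 / 4)
      simp only [hf]
      linarith
    linarith [hle m]
  -- a minimising sequence is a Cauchy sequence
  have hseq : ∀ n : ℕ, ∃ x, f x < i + (1 / 2) ^ n := fun n =>
    exists_lt_of_ciInf_lt (lt_add_of_pos_right i (by positivity))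
  choose u hu using hseq
  have hcauchy : CauchySeq u := by
    rw [Metric.cauchySeq_iff']
    intro ε hε
    obtain ⟨N, hN⟩ := exists_pow_lt_of_lt_one (show 0 < ε ^ 2 / 4 by positivity)
      (by norm_num : (1 / 2 : ℝ) < 1)
    refine ⟨N, fun n hn => ?_⟩
    have h1 := hconv (u n) (u N)
    have h2 := hu n
    have h3 := hu N
    have h4 : (1 / 2 : ℝ) ^ n ≤ (1 / 2) ^ N :=
      pow_le_pow_of_le_one (by norm_num) (by norm_num) hn
    refine (sq_lt_sq₀ dist_nonneg hε.le).1 ?_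
    linarith
  obtain ⟨x, hx⟩ := cauchySeq_tendsto_of_complete hcauchy
  have hmin : f x = i := by
    refine le_antisymm ?_ (hle x)
    have h1 : Filter.Tendsto (fun n : ℕ => i + (1 / 2 : ℝ) ^ n) Filter.atTop (nhds (i + 0)) :=
      tendsto_const_nhds.add (tendsto_pow_atTop_nhds_zero_of_lt_one (by norm_num) (by norm_num))
    rw [add_zero] at h1
    exact le_of_tendsto_of_tendsto' ((hcont.tendsto x).comp hx) h1 fun n => (hu n).le
  refine ⟨x, fun h => dist_eq_zero.1 ?_⟩
  have := hconv (φ h x) x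
  rw [hinv, hmin, sub_self, mul_zero, add_zero] at this
  exact pow_eq_zero_iff two_ne_zero |>.1 (le_antisymm this (sq_nonneg _))

/-! ### Trees of metric spaces -/

/-- The chain distance is the largest pseudo-distance that is at most the length of every step. -/
theorem le_stepEDist {Q : Type*} {step : Q → Q → ℝ≥0∞ → Prop}
    {hstep : ∀ x y l, step x y l → step y x l} {δ : Q → Q → ℝ≥0∞} (h0 : ∀ y, δ y y = 0)
    (htri : ∀ x y z, δ x z ≤ δ x y + δ y z) (h : ∀ y z l, step y z l → δ y z ≤ l) (y z : Q) :
    δ y z ≤ (stepPseudoEMetricSpace step hstep).edist y z := by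
  refine le_iInf₂ fun L hL => ?_
  induction hL with
  | nil => rw [h0]
  | snoc _ hs ih => exact (htri _ _ _).trans (add_le_add ih (h _ _ _ hs))

theorem stepEDist_le {Q : Type*} {step : Q → Q → ℝ≥0∞ → Prop}
    {hstep : ∀ x y l, step x y l → step y x l} {y z : Q} {l : ℝ≥0∞} (h : step y z l) :
    (stepPseudoEMetricSpace step hstep).edist y z ≤ l := by
  have h1 := (StepChain.nil (step := step) y).snoc h
  rw [zero_add] at h1
  exact iInf₂_le l h1

namespace OrientedGraph

variable {V : Type uV} {E : Type uE} {Γ : OrientedGraph V E} {S : Set E}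

/-- The two ends of an edge: the source for `false`, the target for `true`. -/
def endVertex (Γ : OrientedGraph V E) (e : E) : Bool → V
  | false => Γ.src e
  | true => Γ.tgt e

theorem Joined.eq_of {α : Sort*} {u w : V} (h : Γ.Joined S u w) (ψ : V → α)
    (hψ : ∀ e ∈ S, ψ (Γ.src e) = ψ (Γ.tgt e)) : ψ u = ψ w := by
  induction h with
  | rel u w h =>
    obtain ⟨e, he, rfl, rfl⟩ := h
    exact hψ e he
  | refl => rfl
  | symm _ _ _ ih => exact ih.symm
  | trans _ _ _ _ _ ih1 ih2 => exact ih1.trans ih2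

theorem joined_edge {e : E} (he : e ∈ S) : Γ.Joined S (Γ.src e) (Γ.tgt e) :=
  .rel _ _ ⟨e, he, rfl, rfl⟩

end OrientedGraph

/-- A tree of metric spaces: a metric space for every vertex of a tree, and for every edge `k` a
point in each of the spaces at the two ends of `k`. These two points are to be identified, or to be
joined by an interval of length one. -/
structure TreeOfSpaces (J : Type uV) (K : Type uE) extends OrientedGraph J K where
  isTree : toOrientedGraph.IsSpanningTree Set.univ
  space : J → Type uX
  [metric : ∀ j, MetricSpace (space j)]
  srcPt : ∀ k, space (src k)
  tgtPt : ∀ k, space (tgt k)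

namespace TreeOfSpaces

attribute [instance] metric

variable {J : Type uV} {K : Type uE} (𝒯 : TreeOfSpaces.{uV, uE, uX} J K)

/-- A point of the disjoint union of the spaces: an index and a point of the space with that
index. -/
structure Point where
  idx : J
  val : 𝒯.space idx

variable {𝒯} in
/-- The steps whose chains define the distance between points of the union: inside one of the
spaces, or, for free, between two identified points. -/
inductive Step : 𝒯.Point → 𝒯.Point → ℝ≥0∞ → Prop
  | piece (j : J) (x y : 𝒯.space j) : Step ⟨j, x⟩ ⟨j, y⟩ (edist x y)
  | link (k : K) : Step ⟨𝒯.src k, 𝒯.srcPt k⟩ ⟨𝒯.tgt k, 𝒯.tgtPt k⟩ 0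
  | link_symm (k : K) : Step ⟨𝒯.tgt k, 𝒯.tgtPt k⟩ ⟨𝒯.src k, 𝒯.srcPt k⟩ 0

theorem Step.symm {y z : 𝒯.Point} {l : ℝ≥0∞} (h : Step y z l) : Step z y l := by
  cases h with
  | piece j x y => rw [edist_comm]; exact .piece j y x
  | link k => exact .link_symm k
  | link_symm k => exact .link k

/-- The path pseudo-metric on the union, which may take the value `∞` a priori. -/
@[reducible] noncomputable def pointsPseudoEMetricSpace : PseudoEMetricSpace 𝒯.Point :=
  stepPseudoEMetricSpace Step fun _ _ _ h => h.symm

section EDist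

attribute [local instance] pointsPseudoEMetricSpace

theorem edist_le_of_step {y z : 𝒯.Point} {l : ℝ≥0∞} (h : Step y z l) : edist y z ≤ l :=
  stepEDist_le h

theorem edist_link (k : K) :
    edist (⟨𝒯.src k, 𝒯.srcPt k⟩ : 𝒯.Point) ⟨𝒯.tgt k, 𝒯.tgtPt k⟩ = 0 :=
  le_antisymm (𝒯.edist_le_of_step (.link k)) zero_le

theorem edist_ne_top (y z : 𝒯.Point) : edist y z ≠ ⊤ := by
  obtain ⟨i, x⟩ := y
  obtain ⟨j, z⟩ := z
  have h := (𝒯.isTree.joined i j).eq_of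
    (fun j => ∀ z : 𝒯.space j, edist (⟨i, x⟩ : 𝒯.Point) ⟨j, z⟩ ≠ ⊤) ?_
  · refine h.mp (fun z => ?_) z
    exact ne_top_of_le_ne_top (_root_.edist_ne_top x z) (𝒯.edist_le_of_step (.piece i x z))
  · intro k _
    have key : ∀ (j j' : J) (p : 𝒯.space j) (p' : 𝒯.space j'),
        edist (⟨j, p⟩ : 𝒯.Point) ⟨j', p'⟩ = 0 →
        (∀ z : 𝒯.space j, edist (⟨i, x⟩ : 𝒯.Point) ⟨j, z⟩ ≠ ⊤) →
        ∀ z : 𝒯.space j', edist (⟨i, x⟩ : 𝒯.Point) ⟨j', z⟩ ≠ ⊤ := by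
      intro j j' p p' h0 h z
      refine ne_top_of_le_ne_top ?_ (edist_triangle4 _ (⟨j, p⟩ : 𝒯.Point) ⟨j', p'⟩ _)
      rw [h0, add_zero]
      exact ENNReal.add_ne_top.2 ⟨h p, ne_top_of_le_ne_top (_root_.edist_ne_top p' z)
        (𝒯.edist_le_of_step (.piece j' p' z))⟩
    exact propext ⟨key _ _ _ _ (𝒯.edist_link k), key _ _ _ _ ((edist_comm _ _).trans
      (𝒯.edist_link k))⟩

end EDist

noncomputable instance : PseudoMetricSpace 𝒯.Point :=
  @PseudoEMetricSpace.toPseudoMetricSpace _ 𝒯.pointsPseudoEMetricSpace 𝒯.edist_ne_top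

variable {𝒯}

theorem le_edist_of_step {δ : 𝒯.Point → 𝒯.Point → ℝ≥0∞} (h0 : ∀ y, δ y y = 0)
    (htri : ∀ x y z, δ x z ≤ δ x y + δ y z) (hstep : ∀ y z l, Step y z l → δ y z ≤ l)
    (y z : 𝒯.Point) : δ y z ≤ edist y z :=
  le_stepEDist (hstep := fun _ _ _ h => h.symm) h0 htri hstep y z

/-- `i` is on the same side of the edge `k` as the source of `k`. -/
def Near (𝒯 : TreeOfSpaces.{uV, uE, uX} J K) (k : K) (i : J) : Prop :=
  𝒯.Joined (Set.univ \ {k}) (𝒯.src k) i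

theorem near_src (k : K) : 𝒯.Near k (𝒯.src k) := .refl _

theorem not_near_tgt (k : K) : ¬ 𝒯.Near k (𝒯.tgt k) := 𝒯.isTree.bridge k trivial

theorem src_ne_tgt (k : K) : 𝒯.src k ≠ 𝒯.tgt k := fun h =>
  not_near_tgt k (by rw [← h]; exact near_src k)

theorem near_src_iff {k k' : K} (h : k' ≠ k) : 𝒯.Near k (𝒯.src k') ↔ 𝒯.Near k (𝒯.tgt k') := by
  have : 𝒯.Joined (Set.univ \ {k}) (𝒯.src k') (𝒯.tgt k') :=
    OrientedGraph.joined_edge ⟨trivial, h⟩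
  exact ⟨fun h1 => h1.trans _ _ _ this, fun h1 => h1.trans _ _ _ this.symm⟩

/-- `y` is one of the two points which are identified on behalf of the edge `k`. -/
inductive IsEnd (k : K) : 𝒯.Point → Prop
  | src : IsEnd k ⟨𝒯.src k, 𝒯.srcPt k⟩
  | tgt : IsEnd k ⟨𝒯.tgt k, 𝒯.tgtPt k⟩

/-- Some edge at `j` separates `j` from `i`, and `x` is its point in the space of `j`. -/
def IsGate {j : J} (i : J) (x : 𝒯.space j) : Prop :=
  ∃ k, IsEnd k (⟨j, x⟩ : 𝒯.Point) ∧ ¬ (𝒯.Near k j ↔ 𝒯.Near k i)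

theorem IsEnd.ne_of_ne {k k' : K} {j : J} {x : 𝒯.space j} (h : IsEnd k (⟨j, x⟩ : 𝒯.Point))
    (h1 : j ≠ 𝒯.src k') (h2 : j ≠ 𝒯.tgt k') : k' ≠ k := by
  rintro rfl
  cases h with
  | src => exact h1 rfl
  | tgt => exact h2 rfl

theorem isGate_tgt_iff (k : K) (x : 𝒯.space (𝒯.src k)) :
    IsGate (𝒯.tgt k) x ↔ x = 𝒯.srcPt k := by
  constructor
  · rintro ⟨k', h1, h2⟩
    by_cases hk : k = k'
    · subst hk
      generalize hy : (⟨𝒯.src k, x⟩ : 𝒯.Point) = y at h1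
      cases h1 with
      | src => exact eq_of_heq (Point.mk.inj hy).2
      | tgt => exact absurd (Point.mk.inj hy).1 (src_ne_tgt k)
    · exact absurd (near_src_iff hk) h2
  · rintro rfl
    exact ⟨k, .src, fun h => not_near_tgt k (h.1 (near_src k))⟩

theorem isGate_src_iff (k : K) (x : 𝒯.space (𝒯.tgt k)) :
    IsGate (𝒯.src k) x ↔ x = 𝒯.tgtPt k := by
  constructor
  · rintro ⟨k', h1, h2⟩
    by_cases hk : k = k'
    · subst hk
      generalize hy : (⟨𝒯.tgt k, x⟩ : 𝒯.Point) = y at h1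
      cases h1 with
      | src => exact absurd (Point.mk.inj hy).1.symm (src_ne_tgt k)
      | tgt => exact eq_of_heq (Point.mk.inj hy).2
    · exact absurd (near_src_iff hk).symm h2
  · rintro rfl
    exact ⟨k, .tgt, fun h => not_near_tgt k (h.2 (near_src k))⟩

theorem exists_isGate {i j : J} (h : i ≠ j) : ∃ x : 𝒯.space j, IsGate i x := by
  have key := (𝒯.isTree.joined j i).eq_of (fun i => i = j ∨ ∃ x : 𝒯.space j, IsGate i x) ?_
  · exact (key.mp (.inl rfl)).resolve_left h
  · intro k _
    by_cases h1 : j = 𝒯.src k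
    · subst h1
      simp only [true_or, isGate_tgt_iff, exists_eq, or_true]
    · by_cases h2 : j = 𝒯.tgt k
      · subst h2
        simp only [true_or, isGate_src_iff, exists_eq, or_true]
      · have h3 : ∀ x : 𝒯.space j, IsGate (𝒯.src k) x ↔ IsGate (𝒯.tgt k) x := fun x =>
          exists_congr fun k' => and_congr_right fun h4 => by
            rw [near_src_iff (h4.ne_of_ne h1 h2)]
        simp only [h3, Ne.symm h1, Ne.symm h2, false_or]

open Classical in
/-- The retraction of the union onto one of the spaces, which collapses every other space onto the
point through which it is attached. The point `x₀` is only there to make the space non-empty. -/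
noncomputable def retract {j : J} (x₀ : 𝒯.space j) (y : 𝒯.Point) : 𝒯.space j :=
  if h : y.idx = j then h ▸ y.val else @Classical.epsilon _ ⟨x₀⟩ (IsGate y.idx)

theorem retract_self {j : J} (x₀ x : 𝒯.space j) : retract x₀ ⟨j, x⟩ = x := by
  simp [retract]

theorem isGate_retract {i j : J} (h : i ≠ j) (x₀ : 𝒯.space j) (x : 𝒯.space i) :
    IsGate i (retract x₀ ⟨i, x⟩) := by
  rw [retract, dif_neg h]
  exact Classical.epsilon_spec (exists_isGate h)

theorem retract_const {i j : J} (h : i ≠ j) (x₀ : 𝒯.space j) (x y : 𝒯.space i) :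
    retract x₀ ⟨i, x⟩ = retract x₀ ⟨i, y⟩ := by
  rw [retract, dif_neg h, retract, dif_neg h]

/-- An edge `k` which is not at `j` has both ends on the same side of each of the edges at `j`, and
hence the same gate. -/
theorem retract_link {j : J} (x₀ : 𝒯.space j) (k : K) :
    retract x₀ ⟨𝒯.src k, 𝒯.srcPt k⟩ = retract x₀ ⟨𝒯.tgt k, 𝒯.tgtPt k⟩ := by
  by_cases h1 : j = 𝒯.src k
  · subst h1
    rw [retract_self, (isGate_tgt_iff k _).1 (isGate_retract (src_ne_tgt k).symm _ _)]
  · by_cases h2 : j = 𝒯.tgt k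
    · subst h2
      rw [retract_self, (isGate_src_iff k _).1 (isGate_retract (src_ne_tgt k) _ _)]
    · rw [retract, dif_neg (Ne.symm h1), retract, dif_neg (Ne.symm h2)]
      congr 1
      funext x
      exact propext (exists_congr fun k' => and_congr_right fun h4 => by
        rw [near_src_iff (h4.ne_of_ne h1 h2)])

theorem edist_retract_le {j : J} (x₀ : 𝒯.space j) (y z : 𝒯.Point) :
    edist (retract x₀ y) (retract x₀ z) ≤ edist y z := by
  refine le_edist_of_step (δ := fun y z => edist (retract x₀ y) (retract x₀ z))
    (fun _ => edist_self _) (fun _ _ _ => edist_triangle _ _ _) ?_ y z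
  rintro _ _ _ (⟨i, x, y⟩ | k | k)
  · by_cases h : i = j
    · subst h
      rw [retract_self, retract_self]
    · rw [retract_const h x₀ x y, edist_self]
      exact zero_le
  · rw [retract_link, edist_self]
  · rw [retract_link, edist_self]

theorem dist_retract_le {j : J} (x₀ : 𝒯.space j) (y z : 𝒯.Point) :
    dist (retract x₀ y) (retract x₀ z) ≤ dist y z := by
  have h := edist_retract_le x₀ y z
  rwa [edist_dist, edist_dist, ENNReal.ofReal_le_ofReal_iff dist_nonneg] at h

theorem isometry_mk (j : J) : Isometry (fun x : 𝒯.space j => (⟨j, x⟩ : 𝒯.Point)) := by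
  intro x y
  refine le_antisymm (𝒯.edist_le_of_step (.piece j x y)) ?_
  have h := edist_retract_le x (⟨j, x⟩ : 𝒯.Point) ⟨j, y⟩
  rwa [retract_self, retract_self] at h

open Classical in
/-- Cutting the union at the edge `k` and keeping the side of the source. -/
noncomputable def keepSrc (k : K) (y : 𝒯.Point) : 𝒯.Point :=
  if 𝒯.Near k y.idx then y else ⟨𝒯.src k, 𝒯.srcPt k⟩

open Classical in
/-- Cutting the union at the edge `k` and keeping the side of the target. -/
noncomputable def keepTgt (k : K) (y : 𝒯.Point) : 𝒯.Point :=
  if 𝒯.Near k y.idx then ⟨𝒯.tgt k, 𝒯.tgtPt k⟩ else y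

/-- Cutting at an edge decomposes every chain into a chain on either side. -/
theorem edist_keep_le (k : K) (y z : 𝒯.Point) :
    edist (keepSrc k y) (keepSrc k z) + edist (keepTgt k y) (keepTgt k z) ≤ edist y z := by
  refine le_edist_of_step (δ := fun y z => edist (keepSrc k y) (keepSrc k z) +
    edist (keepTgt k y) (keepTgt k z)) (fun _ => by simp only [edist_self, add_zero])
    (fun x y z => ?_) ?_ y z
  · refine (add_le_add (edist_triangle _ (keepSrc k y) _)
      (edist_triangle _ (keepTgt k y) _)).trans_eq ?_
    ring
  · have hlink : ∀ k', edist (keepSrc k (⟨𝒯.src k', 𝒯.srcPt k'⟩ : 𝒯.Point))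
          (keepSrc k ⟨𝒯.tgt k', 𝒯.tgtPt k'⟩) +
        edist (keepTgt k (⟨𝒯.src k', 𝒯.srcPt k'⟩ : 𝒯.Point))
          (keepTgt k ⟨𝒯.tgt k', 𝒯.tgtPt k'⟩) ≤ 0 := by
      intro k'
      by_cases hk : k' = k
      · subst hk
        simp [keepSrc, keepTgt, near_src, not_near_tgt]
      · by_cases h : 𝒯.Near k (𝒯.src k')
        · have h' := (near_src_iff hk).1 h
          simp only [keepSrc, keepTgt, h, h', if_true, edist_self, add_zero]
          exact (𝒯.edist_link k').le
        · have h' := mt (near_src_iff hk).2 h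
          simp only [keepSrc, keepTgt, h, h', if_false, edist_self, zero_add]
          exact (𝒯.edist_link k').le
    rintro _ _ _ (⟨i, x, y⟩ | k' | k')
    · by_cases h : 𝒯.Near k i
      · simp only [keepSrc, keepTgt, h, if_true, edist_self, add_zero]
        exact 𝒯.edist_le_of_step (.piece i x y)
      · simp only [keepSrc, keepTgt, h, if_false, edist_self, zero_add]
        exact 𝒯.edist_le_of_step (.piece i x y)
    · exact hlink k'
    · rw [edist_comm (keepSrc _ _), edist_comm (keepTgt _ _)]
      exact hlink k'

theorem dist_link (k : K) :
    dist (⟨𝒯.src k, 𝒯.srcPt k⟩ : 𝒯.Point) ⟨𝒯.tgt k, 𝒯.tgtPt k⟩ = 0 := by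
  have h := 𝒯.edist_link k
  change edist (⟨𝒯.src k, 𝒯.srcPt k⟩ : 𝒯.Point) ⟨𝒯.tgt k, 𝒯.tgtPt k⟩ = 0 at h
  rw [edist_dist, ENNReal.ofReal_eq_zero] at h
  exact le_antisymm h dist_nonneg

variable (𝒯) in
/-- The tree of spaces with the identifications carried out: points at distance zero are
identified. -/
def Glued : Type (max uV uX) := SeparationQuotient 𝒯.Point

noncomputable instance : MetricSpace 𝒯.Glued :=
  inferInstanceAs (MetricSpace (SeparationQuotient 𝒯.Point))

/-- The gluing map. -/
noncomputable def toGlued (y : 𝒯.Point) : 𝒯.Glued := SeparationQuotient.mk y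

theorem dist_toGlued (y z : 𝒯.Point) : dist (toGlued y) (toGlued z) = dist y z :=
  SeparationQuotient.dist_mk y z

theorem toGlued_surjective : Function.Surjective (toGlued (𝒯 := 𝒯)) :=
  SeparationQuotient.surjective_mk

theorem toGlued_eq_toGlued {y z : 𝒯.Point} : toGlued y = toGlued z ↔ dist y z = 0 := by
  rw [← dist_toGlued, dist_eq_zero]

variable (𝒯) in
/-- The inclusion of one of the spaces in the glued space. -/
noncomputable def ofPiece (j : J) (x : 𝒯.space j) : 𝒯.Glued := toGlued ⟨j, x⟩

theorem dist_ofPiece {i j : J} (x : 𝒯.space i) (y : 𝒯.space j) :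
    dist (𝒯.ofPiece i x) (𝒯.ofPiece j y) = dist (⟨i, x⟩ : 𝒯.Point) ⟨j, y⟩ :=
  dist_toGlued _ _

theorem isometry_ofPiece (j : J) : Isometry (𝒯.ofPiece j) :=
  .of_dist_eq fun x y => (dist_ofPiece x y).trans ((isometry_mk j).dist_eq x y)

theorem exists_eq_ofPiece (y : 𝒯.Glued) : ∃ j x, y = 𝒯.ofPiece j x := by
  obtain ⟨⟨j, x⟩, rfl⟩ := toGlued_surjective y
  exact ⟨j, x, rfl⟩

theorem ofPiece_link (k : K) :
    𝒯.ofPiece (𝒯.src k) (𝒯.srcPt k) = 𝒯.ofPiece (𝒯.tgt k) (𝒯.tgtPt k) :=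
  toGlued_eq_toGlued.2 (dist_link k)

/-- Every path between the two sides of an edge passes through its attaching point. -/
theorem dist_ofPiece_of_near {k : K} {i j : J} (hi : 𝒯.Near k i) (hj : ¬ 𝒯.Near k j)
    (x : 𝒯.space i) (y : 𝒯.space j) :
    dist (𝒯.ofPiece i x) (𝒯.ofPiece j y) =
      dist (𝒯.ofPiece i x) (𝒯.ofPiece _ (𝒯.srcPt k)) +
        dist (𝒯.ofPiece _ (𝒯.srcPt k)) (𝒯.ofPiece j y) := by
  refine le_antisymm (dist_triangle _ _ _) ?_
  have h := edist_keep_le k (⟨i, x⟩ : 𝒯.Point) ⟨j, y⟩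
  simp only [keepSrc, keepTgt, hi, hj, if_true, if_false] at h
  rw [edist_dist, edist_dist, edist_dist, ← ENNReal.ofReal_add dist_nonneg dist_nonneg,
    ENNReal.ofReal_le_ofReal_iff dist_nonneg] at h
  nth_rw 2 [ofPiece_link]
  rwa [dist_ofPiece, dist_ofPiece, dist_ofPiece]

/-- The subtrees with finitely many vertices, given by their sets of vertices and built by adding
one leaf at a time. -/
inductive Subtree (𝒯 : TreeOfSpaces.{uV, uE, uX} J K) : Set J → Prop
  | single (j : J) : Subtree 𝒯 {j}
  | addTgt {C : Set J} (h : Subtree 𝒯 C) (k : K) (hs : 𝒯.src k ∈ C) (ht : 𝒯.tgt k ∉ C) :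
      Subtree 𝒯 (C ∪ {𝒯.tgt k})
  | addSrc {C : Set J} (h : Subtree 𝒯 C) (k : K) (ht : 𝒯.tgt k ∈ C) (hs : 𝒯.src k ∉ C) :
      Subtree 𝒯 (C ∪ {𝒯.src k})

/-- An edge which is not in a subtree does not separate its vertices. -/
theorem Subtree.near_iff {C : Set J} (h : 𝒯.Subtree C) (k : K)
    (hk : 𝒯.src k ∉ C ∨ 𝒯.tgt k ∉ C) : ∀ i ∈ C, ∀ j ∈ C, 𝒯.Near k i ↔ 𝒯.Near k j := by
  induction h with
  | single j =>
    rintro _ rfl _ rfl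
    rfl
  | @addTgt C h k' hs ht ih =>
    have hne : k' ≠ k := by
      rintro rfl
      exact hk.elim (fun h => h (.inl hs)) fun h => h (.inr rfl)
    have ih' := ih (hk.imp (fun h h' => h (.inl h')) fun h h' => h (.inl h'))
    have h1 := near_src_iff (𝒯 := 𝒯) hne
    rintro i (hi | rfl) j (hj | rfl)
    · exact ih' i hi j hj
    · exact (ih' i hi _ hs).trans h1
    · exact h1.symm.trans (ih' _ hs j hj)
    · rfl
  | @addSrc C h k' ht hs ih =>
    have hne : k' ≠ k := by
      rintro rfl
      exact hk.elim (fun h => h (.inr rfl)) fun h => h (.inl ht)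
    have ih' := ih (hk.imp (fun h h' => h (.inl h')) fun h h' => h (.inl h'))
    have h1 := near_src_iff (𝒯 := 𝒯) hne
    rintro i (hi | rfl) j (hj | rfl)
    · exact ih' i hi j hj
    · exact (ih' i hi _ ht).trans h1.symm
    · exact h1.trans (ih' _ ht j hj)
    · rfl

theorem Subtree.exists_superset {C : Set J} (h : 𝒯.Subtree C) (j : J) :
    ∃ C', C ⊆ C' ∧ 𝒯.Subtree C' ∧ j ∈ C' := by
  obtain ⟨i, hi⟩ : C.Nonempty := by
    cases h with
    | single j => exact ⟨j, rfl⟩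
    | addTgt h k hs ht => exact ⟨_, .inr rfl⟩
    | addSrc h k hs ht => exact ⟨_, .inr rfl⟩
  refine ((𝒯.isTree.joined i j).eq_of (fun j => ∃ C', C ⊆ C' ∧ 𝒯.Subtree C' ∧ j ∈ C') ?_).mp
    ⟨C, subset_rfl, h, hi⟩
  intro k _
  refine propext ⟨?_, ?_⟩
  · rintro ⟨C', h1, h2, h3⟩
    by_cases h4 : 𝒯.tgt k ∈ C'
    · exact ⟨C', h1, h2, h4⟩
    · exact ⟨_, h1.trans Set.subset_union_left, h2.addTgt k h3 h4, .inr rfl⟩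
  · rintro ⟨C', h1, h2, h3⟩
    by_cases h4 : 𝒯.src k ∈ C'
    · exact ⟨C', h1, h2, h4⟩
    · exact ⟨_, h1.trans Set.subset_union_left, h2.addSrc k h3 h4, .inr rfl⟩

/-- The part of the glued space over a set of vertices. -/
def part (𝒯 : TreeOfSpaces.{uV, uE, uX} J K) (C : Set J) : Set 𝒯.Glued :=
  {y | ∃ j ∈ C, ∃ x, y = 𝒯.ofPiece j x}

theorem part_union (C D : Set J) : 𝒯.part (C ∪ D) = 𝒯.part C ∪ 𝒯.part D := by
  ext y
  simp only [part, Set.mem_ofPred_eq, Set.mem_union, or_and_right, exists_or]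

theorem part_geodesic_and_stewart (h𝒯 : ∀ j, IsCAT0 (𝒯.space j)) {C : Set J}
    (hC : 𝒯.Subtree C) :
    (∀ p ∈ 𝒯.part C, ∀ q ∈ 𝒯.part C, ∃ γ : ℝ → 𝒯.Glued, IsGeodesicFromTo γ p q) ∧
    ∀ p ∈ 𝒯.part C, ∀ q ∈ 𝒯.part C, ∀ m ∈ 𝒯.part C, ∀ r ∈ 𝒯.part C, StewartAt p q m r := by
  have single : ∀ j,
      (∀ p ∈ 𝒯.part {j}, ∀ q ∈ 𝒯.part {j}, ∃ γ : ℝ → 𝒯.Glued, IsGeodesicFromTo γ p q) ∧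
      ∀ p ∈ 𝒯.part {j}, ∀ q ∈ 𝒯.part {j}, ∀ m ∈ 𝒯.part {j}, ∀ r ∈ 𝒯.part {j},
        StewartAt p q m r := by
    intro j
    have hiso := isometry_ofPiece (𝒯 := 𝒯) j
    constructor
    · rintro _ ⟨_, rfl, p, rfl⟩ _ ⟨_, rfl, q, rfl⟩
      obtain ⟨γ, h0, h1, h2⟩ := (h𝒯 _).exists_geodesic p q
      refine ⟨𝒯.ofPiece _ ∘ γ, by simp [h0], by simp [hiso.dist_eq, h1], ?_⟩
      simpa [hiso.dist_eq] using h2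
    · rintro _ ⟨_, rfl, p, rfl⟩ _ ⟨_, rfl, q, rfl⟩ _ ⟨_, rfl, m, rfl⟩ _ ⟨_, rfl, r, rfl⟩
      have := (h𝒯 _).stewartAt p q m r
      simpa [StewartAt, hiso.dist_eq] using this
  induction hC with
  | single j => exact single j
  | @addTgt C h k hs ht ih =>
    have hw : IsWedge (𝒯.part C) (𝒯.part {𝒯.tgt k}) (𝒯.ofPiece _ (𝒯.srcPt k)) := by
      rintro _ ⟨i, hi, x, rfl⟩ _ ⟨_, rfl, y, rfl⟩
      exact dist_ofPiece_of_near ((h.near_iff k (.inr ht) _ hs i hi).1 (near_src k))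
        (not_near_tgt k) x y
    have hoA : 𝒯.ofPiece _ (𝒯.srcPt k) ∈ 𝒯.part C := ⟨_, hs, _, rfl⟩
    have hoB : 𝒯.ofPiece _ (𝒯.srcPt k) ∈ 𝒯.part {𝒯.tgt k} := ⟨_, rfl, _, ofPiece_link k⟩
    rw [part_union]
    exact ⟨hw.exists_geodesic hoA hoB ih.1 (single _).1, hw.stewartAt hoA hoB ih.2 (single _).2⟩
  | @addSrc C h k ht hs ih =>
    have hw : IsWedge (𝒯.part {𝒯.src k}) (𝒯.part C) (𝒯.ofPiece _ (𝒯.srcPt k)) := by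
      rintro _ ⟨_, rfl, x, rfl⟩ _ ⟨i, hi, y, rfl⟩
      exact dist_ofPiece_of_near (near_src k)
        (fun h' => not_near_tgt k ((h.near_iff k (.inl hs) _ ht i hi).2 h')) x y
    have hoA : 𝒯.ofPiece _ (𝒯.srcPt k) ∈ 𝒯.part {𝒯.src k} := ⟨_, rfl, _, rfl⟩
    have hoB : 𝒯.ofPiece _ (𝒯.srcPt k) ∈ 𝒯.part C := ⟨_, ht, _, ofPiece_link k⟩
    rw [part_union, Set.union_comm]
    exact ⟨hw.exists_geodesic hoA hoB (single _).1 ih.1, hw.stewartAt hoA hoB (single _).2 ih.2⟩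

/-- A tree of CAT(0) spaces is a CAT(0) space: finitely many points are in the part over a finite
subtree, which is an iterated wedge. -/
theorem isCAT0_glued (h𝒯 : ∀ j, IsCAT0 (𝒯.space j)) : IsCAT0 𝒯.Glued := by
  refine .of_stewartAt (fun p q => ?_) (fun p q m r => ?_)
  · obtain ⟨i, p, rfl⟩ := exists_eq_ofPiece p
    obtain ⟨j, q, rfl⟩ := exists_eq_ofPiece q
    obtain ⟨C, h1, hC, hj⟩ := (Subtree.single (𝒯 := 𝒯) i).exists_superset j
    exact (part_geodesic_and_stewart h𝒯 hC).1 _ ⟨i, h1 rfl, p, rfl⟩ _ ⟨j, hj, q, rfl⟩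
  · obtain ⟨i₁, p, rfl⟩ := exists_eq_ofPiece p
    obtain ⟨i₂, q, rfl⟩ := exists_eq_ofPiece q
    obtain ⟨i₃, m, rfl⟩ := exists_eq_ofPiece m
    obtain ⟨i₄, r, rfl⟩ := exists_eq_ofPiece r
    obtain ⟨C₂, h2, hC₂, hi₂⟩ := (Subtree.single (𝒯 := 𝒯) i₁).exists_superset i₂
    obtain ⟨C₃, h3, hC₃, hi₃⟩ := hC₂.exists_superset i₃
    obtain ⟨C₄, h4, hC₄, hi₄⟩ := hC₃.exists_superset i₄
    exact (part_geodesic_and_stewart h𝒯 hC₄).2 _ ⟨i₁, h4 (h3 (h2 rfl)), p, rfl⟩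
      _ ⟨i₂, h4 (h3 hi₂), q, rfl⟩ _ ⟨i₃, h4 hi₃, m, rfl⟩ _ ⟨i₄, hi₄, r, rfl⟩

end TreeOfSpaces

theorem Collapse.edist_mk_le {Y ι : Type*} [PseudoEMetricSpace Y] {A : ι → Set Y} (y z : Y) :
    edist (Collapse.mk A y) (Collapse.mk A z) ≤ edist y z :=
  stepEDist_le (hstep := fun _ _ _ ⟨y, z, h1, h2, h3⟩ => ⟨z, y, h2, h1, h3.trans (edist_comm y z)⟩)
    ⟨y, z, rfl, rfl, rfl⟩

theorem Collapse.le_edist {Y ι : Type*} [PseudoEMetricSpace Y] {A : ι → Set Y}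
    {δ : Collapse A → Collapse A → ℝ≥0∞} (h0 : ∀ p, δ p p = 0)
    (htri : ∀ p q r, δ p r ≤ δ p q + δ q r)
    (h : ∀ y z, δ (Collapse.mk A y) (Collapse.mk A z) ≤ edist y z) (p q : Collapse A) :
    δ p q ≤ edist p q := by
  refine le_stepEDist
    (hstep := fun _ _ _ ⟨y, z, h1, h2, h3⟩ => ⟨z, y, h2, h1, h3.trans (edist_comm y z)⟩)
    h0 htri ?_ p q
  rintro _ _ _ ⟨y, z, rfl, rfl, rfl⟩
  exact h y z

theorem OrientedGraph.edist_edgePoint_le {V : Type uV} {E : Type uE} {Γ : OrientedGraph V E}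
    (e : E) (s t : I) : edist (Γ.edgePoint e s) (Γ.edgePoint e t) ≤ edist s t :=
  stepEDist_le
    (hstep := fun _ _ _ ⟨e, s, t, h1, h2, h3⟩ => ⟨e, t, s, h2, h1, h3.trans (edist_comm s t)⟩)
    ⟨e, s, t, rfl, rfl, rfl⟩

theorem OrientedGraph.le_edist {V : Type uV} {E : Type uE} {Γ : OrientedGraph V E}
    {δ : Γ.Realization → Γ.Realization → ℝ≥0∞} (h0 : ∀ p, δ p p = 0)
    (htri : ∀ p q r, δ p r ≤ δ p q + δ q r)
    (h : ∀ e s t, δ (Γ.edgePoint e s) (Γ.edgePoint e t) ≤ edist s t) (p q : Γ.Realization) :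
    δ p q ≤ edist p q := by
  refine le_stepEDist
    (hstep := fun _ _ _ ⟨e, s, t, h1, h2, h3⟩ => ⟨e, t, s, h2, h1, h3.trans (edist_comm s t)⟩)
    h0 htri ?_ p q
  rintro _ _ _ ⟨e, s, t, rfl, rfl, rfl⟩
  exact h e s t

namespace TreeOfSpaces

variable {J : Type uV} {K : Type uE} (𝒯 : TreeOfSpaces.{uV, uE, uX} J K)

/-! ### Trees of spaces joined by edges of length one -/

/-- The attaching points of an edge. -/
def endPt (k : K) : ∀ b, 𝒯.space (𝒯.endVertex k b)
  | false => 𝒯.srcPt k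
  | true => 𝒯.tgtPt k

/-- The ends of the unit interval. -/
def endParam : Bool → I
  | false => 0
  | true => 1

/-- The vertices and edges of the barycentric subdivision: an edge `k` becomes a vertex `inr k`,
joined to the two ends of `k` by the edges `(k, false)` and `(k, true)`. -/
def subdivideGraph : OrientedGraph (J ⊕ K) (K × Bool) where
  src k := .inr k.1
  tgt k := .inl (𝒯.endVertex k.1 k.2)

theorem isSpanningTree_subdivideGraph : 𝒯.subdivideGraph.IsSpanningTree Set.univ where
  joined := by
    have h1 : ∀ k b, 𝒯.subdivideGraph.Joined Set.univ (.inr k) (.inl (𝒯.endVertex k b)) :=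
      fun k b => OrientedGraph.joined_edge (Γ := 𝒯.subdivideGraph) (e := (k, b)) trivial
    have h2 : ∀ i j, 𝒯.subdivideGraph.Joined Set.univ (.inl i) (.inl j) := by
      intro i j
      refine ((𝒯.isTree.joined i j).eq_of
        (fun j => 𝒯.subdivideGraph.Joined Set.univ (.inl i) (.inl j)) fun k _ => ?_).mp (.refl _)
      exact propext ⟨fun h => h.trans _ _ _ ((h1 k false).symm.trans _ _ _ (h1 k true)),
        fun h => h.trans _ _ _ ((h1 k true).symm.trans _ _ _ (h1 k false))⟩
    rintro (i | k) (j | l)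
    · exact h2 i j
    · exact (h2 i _).trans _ _ _ (h1 l false).symm
    · exact (h1 k false).trans _ _ _ (h2 _ j)
    · exact (h1 k false).trans _ _ _ ((h2 _ _).trans _ _ _ (h1 l false).symm)
  bridge := by
    rintro ⟨k, b⟩ - h
    -- the side of the edge `(k, b)` in the subdivision, in terms of the two sides of `k`
    have key := h.eq_of (Sum.elim
      (fun j => 𝒯.Joined (Set.univ \ {k}) (𝒯.endVertex k b) j)
      (fun l => l ≠ k ∧ 𝒯.Joined (Set.univ \ {k}) (𝒯.endVertex k b) (𝒯.src l))) ?_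
    · exact (key.mpr (.refl _)).1 rfl
    · rintro ⟨l, c⟩ ⟨-, hl⟩
      change (l ≠ k ∧ 𝒯.Joined _ _ _) = 𝒯.Joined _ _ _
      by_cases hlk : l = k
      · subst hlk
        have hc : c ≠ b := fun h => hl (by rw [h]; rfl)
        have hno : ¬ 𝒯.Joined (Set.univ \ {l}) (𝒯.endVertex l b) (𝒯.endVertex l c) := by
          intro hj
          cases b <;> cases c
          · exact hc rfl
          · exact 𝒯.isTree.bridge l trivial hj
          · exact 𝒯.isTree.bridge l trivial hj.symm
          · exact hc rfl
        simp only [ne_eq, not_true_eq_false, false_and, hno]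
      · have hj : 𝒯.Joined (Set.univ \ {k}) (𝒯.src l) (𝒯.endVertex l c) := by
          cases c
          · exact .refl _
          · exact OrientedGraph.joined_edge ⟨trivial, hlk⟩
        simp only [ne_eq, hlk, not_false_eq_true, true_and]
        exact propext ⟨fun h => h.trans _ _ _ hj, fun h => h.trans _ _ _ hj.symm⟩

/-- The spaces of the subdivision: the given ones, and an interval for every edge. -/
def subdivideSpace : J ⊕ K → Type uX
  | .inl j => 𝒯.space j
  | .inr _ => ULift.{uX} I

instance : ∀ j, MetricSpace (𝒯.subdivideSpace j)
  | .inl j => 𝒯.metric j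
  | .inr _ => inferInstanceAs (MetricSpace (ULift.{uX} I))

/-- The tree of spaces obtained by inserting, for every edge, an interval of length one between
its two attaching points. -/
def subdivide : TreeOfSpaces.{max uV uE, uE, uX} (J ⊕ K) (K × Bool) where
  toOrientedGraph := 𝒯.subdivideGraph
  isTree := 𝒯.isSpanningTree_subdivideGraph
  space := 𝒯.subdivideSpace
  srcPt k := ULift.up (endParam k.2)
  tgtPt k := 𝒯.endPt k.1 k.2

/-- A point of the space at `j`, as a point of the disjoint union. -/
def vertexPt (j : J) (x : 𝒯.space j) : 𝒯.subdivide.Point := ⟨.inl j, x⟩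

/-- The point with parameter `t` of the interval of `k`, as a point of the disjoint union. -/
def edgePt (k : K) (t : I) : 𝒯.subdivide.Point := ⟨.inr k, ULift.up t⟩

variable {𝒯}

theorem point_cases {P : 𝒯.subdivide.Point → Prop} (hv : ∀ j x, P (𝒯.vertexPt j x))
    (he : ∀ k t, P (𝒯.edgePt k t)) : ∀ y, P y
  | ⟨.inl j, x⟩ => hv j x
  | ⟨.inr k, ⟨t⟩⟩ => he k t

theorem dist_vertexPt_self (j : J) (x y : 𝒯.space j) :
    dist (𝒯.vertexPt j x) (𝒯.vertexPt j y) = dist x y :=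
  (isometry_mk (𝒯 := 𝒯.subdivide) (.inl j)).dist_eq x y

theorem dist_edgePt_self (k : K) (s t : I) :
    dist (𝒯.edgePt k s) (𝒯.edgePt k t) = dist s t :=
  (isometry_mk (𝒯 := 𝒯.subdivide) (.inr k)).dist_eq (ULift.up s) (ULift.up t)

theorem dist_edgePt_end (k : K) (b : Bool) :
    dist (𝒯.edgePt k (endParam b)) (𝒯.vertexPt _ (𝒯.endPt k b)) = 0 :=
  dist_link (𝒯 := 𝒯.subdivide) (k, b)

theorem step_edgePt_cases {y z : 𝒯.subdivide.Point} {l : ℝ≥0∞} (h : Step y z l) :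
    (∃ j x x', y = 𝒯.vertexPt j x ∧ z = 𝒯.vertexPt j x' ∧ l = edist x x') ∨
    (∃ k s t, y = 𝒯.edgePt k s ∧ z = 𝒯.edgePt k t ∧ l = edist s t) ∨
    (∃ k b, y = 𝒯.edgePt k (endParam b) ∧ z = 𝒯.vertexPt _ (𝒯.endPt k b) ∧ l = 0) ∨
    (∃ k b, z = 𝒯.edgePt k (endParam b) ∧ y = 𝒯.vertexPt _ (𝒯.endPt k b) ∧ l = 0) := by
  cases h with
  | piece j x y =>
    rcases j with j | k
    · exact .inl ⟨j, x, y, rfl, rfl, rfl⟩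
    · exact .inr (.inl ⟨k, x.down, y.down, rfl, rfl, rfl⟩)
  | link k => exact .inr (.inr (.inl ⟨k.1, k.2, rfl, rfl, rfl⟩))
  | link_symm k => exact .inr (.inr (.inr ⟨k.1, k.2, rfl, rfl, rfl⟩))

theorem isEnd_edge {k : K × Bool} {l : K} {t : 𝒯.subdivide.space (.inr l)}
    (h : IsEnd k (⟨.inr l, t⟩ : 𝒯.subdivide.Point)) :
    k.1 = l ∧ t = ULift.up (endParam k.2) := by
  generalize hy : (⟨.inr l, t⟩ : 𝒯.subdivide.Point) = y at h
  cases h with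
  | src =>
    have h1 : l = k.1 := Sum.inr_injective (Point.mk.inj hy).1
    subst h1
    exact ⟨rfl, eq_of_heq (Point.mk.inj hy).2⟩
  | tgt => exact absurd (Point.mk.inj hy).1 Sum.inr_ne_inl

/-- Seen from an interval, every point outside is behind one of its two ends. -/
theorem exists_end_dist_le (k : K) {z : 𝒯.subdivide.Point} (hz : z.idx ≠ .inr k) :
    ∃ b, ∀ s, dist s (endParam b) ≤ dist (𝒯.edgePt k s) z := by
  obtain ⟨i, z⟩ := z
  let x₀ : 𝒯.subdivide.space (.inr k) := ULift.up 0
  obtain ⟨l, hl, -⟩ := isGate_retract (𝒯 := 𝒯.subdivide) hz x₀ z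
  refine ⟨l.2, fun s => ?_⟩
  have h1 := dist_retract_le (𝒯 := 𝒯.subdivide) x₀ (𝒯.edgePt k s) ⟨i, z⟩
  have h2 : retract x₀ (𝒯.edgePt k s) = ULift.up s :=
    retract_self (𝒯 := 𝒯.subdivide) x₀ (ULift.up s)
  rw [h2, (isEnd_edge hl).2] at h1
  exact h1

theorem one_le_dist_vertexPt {i j : J} (h : i ≠ j) (x : 𝒯.space i) (y : 𝒯.space j) :
    1 ≤ dist (𝒯.vertexPt i x) (𝒯.vertexPt j y) := by
  -- the first edge `k` on the way from `i` to `j`, which starts at `i` with its end `b`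
  obtain ⟨a, ⟨k, b⟩, ha, hk⟩ := exists_isGate (𝒯 := 𝒯.subdivide)
    (i := .inl j) (j := .inl i) fun h' => h (Sum.inl_injective h').symm
  have hi : i = 𝒯.endVertex k b := by
    generalize hy : (⟨.inl i, a⟩ : 𝒯.subdivide.Point) = y at ha
    cases ha with
    | src => exact absurd (Point.mk.inj hy).1 Sum.inl_ne_inr
    | tgt => exact Sum.inl_injective (Point.mk.inj hy).1
  have hik : ¬ 𝒯.subdivide.Near (k, b) (.inl i) := by
    rw [hi]
    exact not_near_tgt (𝒯 := 𝒯.subdivide) (k, b)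
  have hjk : 𝒯.subdivide.Near (k, b) (.inl j) := by
    by_contra h'
    exact hk (iff_of_false hik h')
  let x₀ : 𝒯.subdivide.space (.inr k) := ULift.up 0
  have key := dist_retract_le (𝒯 := 𝒯.subdivide) x₀ (𝒯.vertexPt i x) (𝒯.vertexPt j y)
  obtain ⟨⟨l, c⟩, hl1, hl2⟩ := isGate_retract (𝒯 := 𝒯.subdivide) (i := .inl i) (j := .inr k)
    Sum.inl_ne_inr x₀ x
  obtain ⟨⟨l', c'⟩, hl1', hl2'⟩ := isGate_retract (𝒯 := 𝒯.subdivide) (i := .inl j) (j := .inr k)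
    Sum.inl_ne_inr x₀ y
  obtain ⟨rfl, h1⟩ := isEnd_edge hl1
  obtain ⟨rfl, h2⟩ := isEnd_edge hl1'
  rw [vertexPt, vertexPt, h1, h2] at key
  refine le_trans ?_ key
  change 1 ≤ dist (endParam c) (endParam c')
  dsimp only at *
  -- so `i` is retracted to the end `b` of the interval, and `j` to the other end
  have hc : c' ≠ b := by
    rintro rfl
    exact hl2' (iff_of_true (near_src (𝒯 := 𝒯.subdivide) (l', c')) hjk)
  have hc' : c = b := by
    by_contra hcb
    refine hl2 (iff_of_true (near_src (𝒯 := 𝒯.subdivide) (l', c)) ?_)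
    have e1 : 𝒯.subdivide.Near (l', c) (.inr l') := near_src (𝒯 := 𝒯.subdivide) (l', c)
    have e2 := (near_src_iff (𝒯 := 𝒯.subdivide) (k := (l', c)) (k' := (l', b))
      fun h' => hcb (Prod.mk.inj h').2.symm).1 e1
    rw [hi]
    exact e2
  subst hc'
  cases c <;> cases c' <;> simp [endParam, Subtype.dist_eq] at hc ⊢

/-! ### Completeness -/

variable (𝒯) in
/-- A point of the space at `j`, as a point of the glued space. -/
noncomputable def vertexIncl (j : J) (x : 𝒯.space j) : 𝒯.subdivide.Glued :=
  toGlued (𝒯.vertexPt j x)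

variable (𝒯) in
/-- The inclusion of the interval of the edge `k` in the glued space. -/
noncomputable def edgeIncl (k : K) (t : I) : 𝒯.subdivide.Glued :=
  toGlued (𝒯.edgePt k t)

theorem isometry_vertexIncl (j : J) : Isometry (𝒯.vertexIncl j) :=
  .of_dist_eq fun x y => (dist_toGlued _ _).trans (dist_vertexPt_self j x y)

theorem isometry_edgeIncl (k : K) : Isometry (𝒯.edgeIncl k) :=
  .of_dist_eq fun x y => (dist_toGlued _ _).trans (dist_edgePt_self k x y)

theorem edgeIncl_end (k : K) (b : Bool) :
    𝒯.edgeIncl k (endParam b) = 𝒯.vertexIncl _ (𝒯.endPt k b) :=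
  toGlued_eq_toGlued.2 (dist_edgePt_end k b)

theorem glued_cases {P : 𝒯.subdivide.Glued → Prop} (hv : ∀ j x, P (𝒯.vertexIncl j x))
    (he : ∀ k t, P (𝒯.edgeIncl k t)) (y : 𝒯.subdivide.Glued) : P y := by
  obtain ⟨y, rfl⟩ := toGlued_surjective y
  exact point_cases (P := fun y => P (toGlued y)) hv he y

theorem exists_end_dist_edgeIncl_le (k : K) {z : 𝒯.subdivide.Glued}
    (hz : z ∉ Set.range (𝒯.edgeIncl k)) :
    ∃ b, ∀ s, dist (𝒯.edgeIncl k s) (𝒯.edgeIncl k (endParam b)) ≤ dist (𝒯.edgeIncl k s) z := by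
  obtain ⟨⟨i, z⟩, rfl⟩ := toGlued_surjective z
  have hi : i ≠ .inr k := by
    rintro rfl
    exact hz ⟨z.down, rfl⟩
  obtain ⟨b, hb⟩ := exists_end_dist_le k (z := ⟨i, z⟩) hi
  refine ⟨b, fun s => ?_⟩
  rw [(isometry_edgeIncl k).dist_eq]
  exact (hb s).trans_eq (dist_toGlued _ _).symm

/-- The union of the spaces at the vertices is complete, because they are at distance at least one
from each other. -/
theorem isComplete_iUnion_vertexIncl [∀ j, CompleteSpace (𝒯.space j)] :
    IsComplete (⋃ j, Set.range (𝒯.vertexIncl j)) := by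
  refine isComplete_iUnion_separated (fun j => ?_) (Metric.dist_mem_uniformity zero_lt_one) ?_
  · exact (isometry_vertexIncl j).isUniformInducing.isComplete_range
  · rintro i j _ ⟨x, rfl⟩ _ ⟨y, rfl⟩ (h : dist (𝒯.vertexIncl i x) (𝒯.vertexIncl j y) < 1)
    by_contra hij
    have := one_le_dist_vertexPt hij x y
    rw [vertexIncl, vertexIncl, dist_toGlued] at h
    exact absurd h this.not_gt

/-- A Cauchy sequence either approaches the union of the spaces at the vertices, or stays away from
it, and then is eventually in the interval of a single edge. -/
theorem completeSpace_glued [∀ j, CompleteSpace (𝒯.space j)] :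
    CompleteSpace 𝒯.subdivide.Glued := by
  refine Metric.complete_of_cauchySeq_tendsto fun u hu => ?_
  set A : Set 𝒯.subdivide.Glued := ⋃ j, Set.range (𝒯.vertexIncl j) with hA
  have hmem : ∀ j x, 𝒯.vertexIncl j x ∈ A := fun j x => Set.mem_iUnion.2 ⟨j, x, rfl⟩
  have hne : A.Nonempty := glued_cases (P := fun _ => A.Nonempty) (fun j x => ⟨_, hmem j x⟩)
    (fun k _ => ⟨_, hmem _ (𝒯.srcPt k)⟩) (u 0)
  obtain ⟨L, hL⟩ := cauchySeq_tendsto_of_complete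
    ((Metric.uniformContinuous_infDist_pt A).comp_cauchySeq hu)
  have hL0 : 0 ≤ L := ge_of_tendsto' hL fun n => Metric.infDist_nonneg
  rcases hL0.eq_or_lt with rfl | hpos
  · -- replace `u` by nearby points `v` of `A`
    have hv : ∀ n : ℕ, ∃ v ∈ A, dist (u n) v < Metric.infDist (u n) A + 1 / ((n : ℝ) + 1) :=
      fun n => (Metric.infDist_lt_iff hne).1 (lt_add_of_pos_right _ (by positivity))
    choose v hvA hv using hv
    have hd : Filter.Tendsto (fun n => dist (u n) (v n)) Filter.atTop (nhds 0) := by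
      refine squeeze_zero (fun _ => dist_nonneg) (fun n => (hv n).le) ?_
      simpa using hL.add tendsto_one_div_add_atTop_nhds_zero_nat
    have hvc : CauchySeq v := by
      rw [Metric.cauchySeq_iff] at hu ⊢
      intro ε hε
      obtain ⟨N₁, hN₁⟩ := hu (ε / 3) (by positivity)
      obtain ⟨N₂, hN₂⟩ := 
        (hd.eventually_lt_const (show 0 < ε / 3 by positivity)).exists_forall_of_atTop
      refine ⟨max N₁ N₂, fun m hm n hn => ?_⟩
      have h1 := hN₁ m (le_of_max_le_left hm) n (le_of_max_le_left hn)
      have h2 := hN₂ m (le_of_max_le_right hm)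
      have h3 := hN₂ n (le_of_max_le_right hn)
      have h4 := dist_triangle4 (v m) (u m) (u n) (v n)
      rw [dist_comm (v m) (u m)] at h4
      linarith
    obtain ⟨y, -, hy⟩ := cauchySeq_tendsto_of_isComplete isComplete_iUnion_vertexIncl hvA hvc
    exact ⟨y, (tendsto_iff_of_dist hd).2 hy⟩
  · -- the distance from `u N` to the ends of its edge is too large for leaving this edge later on
    obtain ⟨N₁, hN₁⟩ := (hL.eventually_const_lt (half_lt_self hpos)).exists_forall_of_atTop
    obtain ⟨N₂, hN₂⟩ := Metric.cauchySeq_iff.1 hu (L / 2) (by positivity)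
    set N := max N₁ N₂ with hN
    have hfar : L / 2 < Metric.infDist (u N) A := hN₁ N (le_max_left _ _)
    obtain ⟨k, s, hs⟩ : ∃ k s, u N = 𝒯.edgeIncl k s := by
      refine glued_cases (P := fun y => L / 2 < Metric.infDist y A → ∃ k s, y = 𝒯.edgeIncl k s)
        (fun j x h => ?_) (fun k s _ => ⟨k, s, rfl⟩) (u N) hfar
      rw [Metric.infDist_zero_of_mem (hmem j x)] at h
      linarith
    have hstay : ∀ n, u (n + N) ∈ Set.range (𝒯.edgeIncl k) := by
      intro n
      by_contra hn
      obtain ⟨b, hb⟩ := exists_end_dist_edgeIncl_le k hn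
      have h1 := hb s
      have h2 := hN₂ N (le_max_right _ _) (n + N) ((le_max_right _ _).trans (Nat.le_add_left _ _))
      have h3 : Metric.infDist (u N) A ≤ dist (𝒯.edgeIncl k s) (𝒯.edgeIncl k (endParam b)) := by
        rw [hs, edgeIncl_end]
        exact Metric.infDist_le_dist_of_mem (hmem _ _)
      rw [hs] at h2 h3
      rw [hs] at hfar
      linarith
    have hcomp : IsComplete (Set.range (𝒯.edgeIncl k)) :=
      (isometry_edgeIncl k).isUniformInducing.isComplete_range
    obtain ⟨y, -, hy⟩ := cauchySeq_tendsto_of_isComplete hcomp hstay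
      (hu.comp_tendsto (Filter.tendsto_add_atTop_nat N))
    exact ⟨y, (Filter.tendsto_add_atTop_iff_nat N).1 hy⟩

theorem isCAT0_subdivide (h𝒯 : ∀ j, IsCAT0 (𝒯.space j)) : IsCAT0 𝒯.subdivide.Glued := by
  refine isCAT0_glued ?_
  rintro (j | k)
  · exact h𝒯 j
  · exact isCAT0_unitInterval.of_isometry (f := (ULift.up : I → ULift.{uX} I))
      (fun _ _ => rfl) ULift.up_surjective

/-! ### Collapsing the spaces at the vertices -/

variable (𝒯) in
/-- The map from the disjoint union to the realisation of the tree which collapses the space at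
every vertex. -/
def pointToReal (y : 𝒯.subdivide.Point) : 𝒯.Realization :=
  match y with
  | ⟨.inl j, _⟩ => 𝒯.vertexPoint j
  | ⟨.inr k, t⟩ => 𝒯.edgePoint k t.down

theorem edgePoint_end (k : K) (b : Bool) :
    𝒯.edgePoint k (endParam b) = 𝒯.vertexPoint (𝒯.endVertex k b) := by
  cases b
  · exact (Quot.sound (.src k)).symm
  · exact (Quot.sound (.tgt k)).symm

theorem edist_pointToReal_le (y z : 𝒯.subdivide.Point) :
    edist (𝒯.pointToReal y) (𝒯.pointToReal z) ≤ edist y z := by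
  refine le_edist_of_step (δ := fun y z => edist (𝒯.pointToReal y) (𝒯.pointToReal z))
    (fun _ => edist_self _) (fun _ _ _ => edist_triangle _ _ _) (fun y z l h => ?_) y z
  obtain ⟨j, x, x', rfl, rfl, rfl⟩ | ⟨k, s, t, rfl, rfl, rfl⟩ | ⟨k, b, rfl, rfl, rfl⟩ |
    ⟨k, b, rfl, rfl, rfl⟩ := step_edgePt_cases h
  · exact (edist_self _).trans_le zero_le
  · change edist (𝒯.edgePoint k s) (𝒯.edgePoint k t) ≤ _
    exact OrientedGraph.edist_edgePoint_le k s t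
  · exact (congrArg (edist · _) (edgePoint_end k b)).trans_le (edist_self _).le
  · exact (congrArg (edist _ ·) (edgePoint_end k b)).trans_le (edist_self _).le

theorem eq_endParam_of_dist_eq_zero {k : K} {t : I} {z : 𝒯.subdivide.Point}
    (hz : z.idx ≠ .inr k) (h : dist (𝒯.edgePt k t) z = 0) : ∃ b, t = endParam b := by
  obtain ⟨b, hb⟩ := exists_end_dist_le k hz
  exact ⟨b, dist_le_zero.1 ((hb t).trans_eq h)⟩

theorem eq_of_dist_vertexPt_eq_zero {i j : J} {x : 𝒯.space i} {y : 𝒯.space j}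
    (h : dist (𝒯.vertexPt i x) (𝒯.vertexPt j y) = 0) : i = j := by
  by_contra hij
  have := one_le_dist_vertexPt hij x y
  linarith

theorem pointToReal_of_dist_vertexPt {j : J} {x : 𝒯.space j} {z : 𝒯.subdivide.Point}
    (h : dist z (𝒯.vertexPt j x) = 0) : 𝒯.pointToReal z = 𝒯.vertexPoint j := by
  revert h
  refine point_cases (P := fun z => dist z (𝒯.vertexPt j x) = 0 →
    𝒯.pointToReal z = 𝒯.vertexPoint j) (fun i y h => ?_) (fun k t h => ?_) z
  · exact congrArg 𝒯.vertexPoint (eq_of_dist_vertexPt_eq_zero h)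
  · obtain ⟨b, rfl⟩ := eq_endParam_of_dist_eq_zero (z := 𝒯.vertexPt j x) Sum.inl_ne_inr h
    have h1 : dist (𝒯.vertexPt _ (𝒯.endPt k b)) (𝒯.vertexPt j x) = 0 := by
      rw [← toGlued_eq_toGlued] at h ⊢
      exact (edgeIncl_end k b).symm.trans h
    rw [← eq_of_dist_vertexPt_eq_zero h1]
    exact edgePoint_end k b

theorem pointToReal_eq_of_dist_eq_zero {y z : 𝒯.subdivide.Point} (h : dist y z = 0) :
    𝒯.pointToReal y = 𝒯.pointToReal z := by
  revert h
  refine point_cases (P := fun z => dist y z = 0 → 𝒯.pointToReal y = 𝒯.pointToReal z)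
    (fun j x h => ?_) (fun k t h => ?_) z
  · exact pointToReal_of_dist_vertexPt h
  · revert h
    refine point_cases (P := fun y => dist y (𝒯.edgePt k t) = 0 →
      𝒯.pointToReal y = 𝒯.edgePoint k t) (fun j x h => ?_) (fun l s h => ?_) y
    · exact (pointToReal_of_dist_vertexPt ((dist_comm _ _).trans h)).symm
    · by_cases hkl : l = k
      · subst hkl
        rw [dist_edgePt_self, dist_eq_zero] at h
        exact congrArg (𝒯.edgePoint l) h
      · obtain ⟨b, rfl⟩ := eq_endParam_of_dist_eq_zero (z := 𝒯.edgePt l s)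
          (fun h => hkl (Sum.inr_injective h)) ((dist_comm _ _).trans h)
        have h1 : dist (𝒯.edgePt l s) (𝒯.vertexPt _ (𝒯.endPt k b)) = 0 := by
          rw [← toGlued_eq_toGlued] at h ⊢
          exact h.trans (edgeIncl_end k b)
        exact (pointToReal_of_dist_vertexPt h1).trans (edgePoint_end k b).symm

variable (𝒯) in
/-- The map from the glued space to the realisation of the tree which collapses the space at every
vertex. -/
noncomputable def toReal (y : 𝒯.subdivide.Glued) : 𝒯.Realization :=
  𝒯.pointToReal (Function.surjInv toGlued_surjective y)

theorem toReal_toGlued (y : 𝒯.subdivide.Point) : 𝒯.toReal (toGlued y) = 𝒯.pointToReal y :=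
  pointToReal_eq_of_dist_eq_zero (toGlued_eq_toGlued.1 (Function.surjInv_eq toGlued_surjective _))

theorem edist_toReal_le (y z : 𝒯.subdivide.Glued) :
    edist (𝒯.toReal y) (𝒯.toReal z) ≤ edist y z := by
  obtain ⟨y, rfl⟩ := toGlued_surjective y
  obtain ⟨z, rfl⟩ := toGlued_surjective z
  rw [toReal_toGlued, toReal_toGlued, edist_dist, dist_toGlued, ← edist_dist]
  exact edist_pointToReal_le y z

/-- Collapsing the spaces at some of the vertices, the other ones being singletons, turns the glued
space into the realisation of the tree. -/
theorem exists_collapse_isometryEquiv {ι : Type*} (p : ι → J) (A : ι → Set 𝒯.subdivide.Glued)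
    (hA : ∀ i, A i = Set.range (𝒯.vertexIncl (p i)))
    (hne : ∀ j, Nonempty (𝒯.space j)) (hsub : ∀ j, j ∉ Set.range p → Subsingleton (𝒯.space j)) :
    ∃ Φ : Collapse A ≃ᵢ 𝒯.Realization, ∀ y, Φ (Collapse.mk A y) = 𝒯.toReal y := by
  have hmk : ∀ j (x y : 𝒯.space j),
      Collapse.mk A (𝒯.vertexIncl j x) = Collapse.mk A (𝒯.vertexIncl j y) := by
    intro j x y
    by_cases hj : j ∈ Set.range p
    · obtain ⟨i, rfl⟩ := hj
      exact Quot.sound ⟨i, by rw [hA]; exact ⟨x, rfl⟩, by rw [hA]; exact ⟨y, rfl⟩⟩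
    · have := hsub j hj
      rw [Subsingleton.elim x y]
  have hend : ∀ k b (x : 𝒯.space (𝒯.endVertex k b)),
      Collapse.mk A (𝒯.vertexIncl _ x) = Collapse.mk A (𝒯.edgeIncl k (endParam b)) :=
    fun k b x => (hmk _ x (𝒯.endPt k b)).trans (congrArg _ (edgeIncl_end k b).symm)
  let Φ : Collapse A → 𝒯.Realization := Quot.lift 𝒯.toReal (by
    rintro y y' ⟨i, hy, hy'⟩
    rw [hA] at hy hy'
    obtain ⟨x, rfl⟩ := hy
    obtain ⟨x', rfl⟩ := hy'
    exact (toReal_toGlued (𝒯.vertexPt _ x)).trans (toReal_toGlued (𝒯.vertexPt _ x')).symm)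
  let Ψ : 𝒯.Realization → Collapse A := Quot.lift
    (Sum.elim (fun j => Collapse.mk A (𝒯.vertexIncl j (hne j).some))
      (fun kt => Collapse.mk A (𝒯.edgeIncl kt.1 kt.2))) (by
    rintro _ _ (k | k)
    · exact hend k false _
    · exact hend k true _)
  have hΨΦ : ∀ y, Ψ (Φ y) = y := by
    rintro ⟨y⟩
    refine glued_cases (P := fun y => Ψ (Φ (Collapse.mk A y)) = Collapse.mk A y)
      (fun j x => ?_) (fun k t => ?_) y
    · exact (congrArg Ψ (toReal_toGlued _)).trans (hmk j _ x)
    · exact congrArg Ψ (toReal_toGlued _)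
  have hΦΨ : ∀ y, Φ (Ψ y) = y := by
    rintro ⟨j | ⟨k, t⟩⟩
    · exact toReal_toGlued _
    · exact toReal_toGlued _
  have h1 : ∀ y z, edist (Φ y) (Φ z) ≤ edist y z := by
    exact Collapse.le_edist (δ := fun y z => edist (Φ y) (Φ z)) (fun _ => edist_self _)
      (fun _ _ _ => edist_triangle _ _ _) edist_toReal_le
  have h2 : ∀ y z, edist (Ψ y) (Ψ z) ≤ edist y z := by
    refine OrientedGraph.le_edist (δ := fun y z => edist (Ψ y) (Ψ z)) (fun _ => edist_self _)
      (fun _ _ _ => edist_triangle _ _ _) fun k s t => ?_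
    rw [← (isometry_edgeIncl (𝒯 := 𝒯) k).edist_eq s t]
    exact Collapse.edist_mk_le _ _
  refine ⟨⟨⟨Φ, Ψ, hΨΦ, hΦΨ⟩, fun y z => le_antisymm (h1 y z) ?_⟩, fun y => rfl⟩
  have h3 := h2 (Φ y) (Φ z)
  rwa [hΨΦ, hΨΦ] at h3

end TreeOfSpaces

/-! ### Potentials on spanning trees -/

namespace OrientedGraph

variable {V : Type uV} {E : Type uE} {Γ : OrientedGraph V E} {S : Set E}

theorem joined_endVertex {e : E} (he : e ∈ S) (b : Bool) :
    Γ.Joined S (Γ.endVertex e b) (Γ.endVertex e !b) := by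
  cases b
  · exact joined_edge he
  · exact (joined_edge he).symm

/-- `u` is joined to `r` by a path of length `n` in `S`. -/
def Reach (Γ : OrientedGraph V E) (S : Set E) (r : V) : ℕ → V → Prop
  | 0, u => u = r
  | n + 1, u => ∃ e ∈ S, ∃ b, Γ.endVertex e b = u ∧ Reach Γ S r n (Γ.endVertex e !b)

theorem IsSpanningTree.exists_reach (hS : Γ.IsSpanningTree S) (r u : V) : ∃ n, Γ.Reach S r n u := by
  refine ((hS.joined r u).eq_of (fun u => ∃ n, Γ.Reach S r n u) fun e he => ?_).mp ⟨0, rfl⟩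
  exact propext ⟨fun ⟨n, hn⟩ => ⟨n + 1, e, he, true, rfl, hn⟩,
    fun ⟨n, hn⟩ => ⟨n + 1, e, he, false, rfl, hn⟩⟩

/-- In a tree with a root `r` there is a function `d`, the distance from the root, such that every
other vertex `u` is joined to a vertex with a smaller value: take the last edge of a shortest path.
The Boolean tells at which end of this edge `u` is. -/
theorem IsSpanningTree.exists_parent (hS : Γ.IsSpanningTree S) (r : V) :
    ∃ d : V → ℕ, ∀ u, u ≠ r → ∃ f : E × Bool, f.1 ∈ S ∧
      Γ.endVertex f.1 f.2 = u ∧ d (Γ.endVertex f.1 !f.2) < d u := by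
  classical
  refine ⟨fun u => Nat.find (hS.exists_reach r u), fun u hur => ?_⟩
  have hu := Nat.find_spec (hS.exists_reach r u)
  rcases hn : Nat.find (hS.exists_reach r u) with _ | n
  · rw [hn] at hu
    exact absurd hu hur
  · rw [hn] at hu
    obtain ⟨e, he, b, hb, h⟩ := hu
    exact ⟨(e, b), he, hb, (Nat.find_min' _ h).trans_lt ((Nat.lt_succ_self n).trans_eq hn.symm)⟩

/-- On a tree, every function `T` on the edges with values in a group is the difference of a
function on the vertices. It is defined recursively along the paths from a root; every edge is the
last edge of one of these paths, because otherwise removing it would not disconnect the tree. -/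
theorem IsSpanningTree.exists_potential (hS : Γ.IsSpanningTree S) {H : Type*} [Group H]
    (T : E → H) : ∃ p : V → H, ∀ e ∈ S, p (Γ.tgt e) = p (Γ.src e) * T e := by
  classical
  rcases isEmpty_or_nonempty V with hV | ⟨⟨r⟩⟩
  · exact ⟨fun _ => 1, fun e => (hV.false (Γ.src e)).elim⟩
  obtain ⟨d, hd⟩ := hS.exists_parent r
  choose f hfS hfu hfd using hd
  let p : V → H := (measure d).wf.fix fun u ih =>
    if h : u = r then 1
    else ih _ (hfd u h) * (if (f u h).2 then T (f u h).1 else (T (f u h).1)⁻¹)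
  have hp : ∀ u (h : u ≠ r), p u = p (Γ.endVertex (f u h).1 !(f u h).2) *
      (if (f u h).2 then T (f u h).1 else (T (f u h).1)⁻¹) := by
    intro u h
    exact ((measure d).wf.fix_eq _ u).trans (dif_neg h)
  refine ⟨p, fun e he => ?_⟩
  obtain ⟨u, hu, hue⟩ : ∃ u, ∃ h : u ≠ r, (f u h).1 = e := by
    by_contra hcon
    push Not at hcon
    have hr : ∀ n u, d u = n → Γ.Joined (S \ {e}) u r := by
      intro n
      induction n using Nat.strong_induction_on with
      | _ n ih =>
        rintro u rfl
        by_cases h : u = r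
        · subst h
          exact .refl _
        · have h1 := joined_endVertex (Γ := Γ) (S := S \ {e}) ⟨hfS u h, hcon u h⟩ (f u h).2
          rw [hfu u h] at h1
          exact h1.trans _ _ _ (ih _ (hfd u h) _ rfl)
    exact hS.bridge e he ((hr _ _ rfl).trans _ _ _ (hr _ _ rfl).symm)
  have h1 := hfu u hu
  have h2 := hp u hu
  rw [hue] at h1 h2
  generalize (f u hu).2 = b at h1 h2
  subst h1
  cases b
  · change p (Γ.src e) = p (Γ.tgt e) * (T e)⁻¹ at h2
    rw [h2, inv_mul_cancel_right]
  · exact h2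

end OrientedGraph

/-! ### Homomorphisms from the fundamental group of a graph of groups -/

namespace GraphOfGroups

variable {V : Type uV} {E : Type uE} (G : GraphOfGroups.{uV, uE, uG, uH} V E) (S : Set E)

theorem exists_lift {H : Type*} [Group H] (ρ : ∀ u, G.vertexGroup u →* H) (T : E → H)
    (hconj : ∀ e a, T e * ρ _ (G.tgtHom e a) * (T e)⁻¹ = ρ _ (G.srcHom e a))
    (hT : ∀ e ∈ S, T e = 1) :
    ∃ Φ : G.FundamentalGroup S →* H,
      (∀ u g, Φ (G.vertexHom S u g) = ρ u g) ∧ ∀ e, Φ (G.stableLetter S e) = T e := by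
  let Ψ : G.BigGroup →* H := Monoid.Coprod.lift (Monoid.CoprodI.lift ρ) (FreeGroup.lift T)
  have hv : ∀ u g, Ψ (Monoid.Coprod.inl (Monoid.CoprodI.of (i := u) g)) = ρ u g := fun u g =>
    Monoid.CoprodI.lift_of ρ g
  have he : ∀ e, Ψ (Monoid.Coprod.inr (FreeGroup.of e)) = T e := fun e => FreeGroup.lift_apply_of
  have hker : Subgroup.normalClosure {x | G.Relator S x} ≤ Ψ.ker := by
    refine Subgroup.normalClosure_le_normal ?_
    rintro _ (⟨e, a⟩ | ⟨e, heS⟩)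
    · change Ψ _ = 1
      rw [map_mul, map_mul, map_mul, map_inv, map_inv, hv, hv, he, hconj, mul_inv_cancel]
    · change Ψ _ = 1
      rw [he, hT e heS]
  exact ⟨QuotientGroup.lift _ Ψ hker, hv, he⟩

/-- The fundamental group is generated by the vertex groups and the edges. -/
theorem mem_of_generators (N : Subgroup (G.FundamentalGroup S))
    (hv : ∀ u g, G.vertexHom S u g ∈ N) (he : ∀ e, G.stableLetter S e ∈ N)
    (x : G.FundamentalGroup S) : x ∈ N := by
  obtain ⟨x, rfl⟩ := QuotientGroup.mk'_surjective _ x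
  change x ∈ N.comap (QuotientGroup.mk' _)
  induction x using Monoid.Coprod.induction_on with
  | inl m =>
    induction m using Monoid.CoprodI.induction_on with
    | one => rw [map_one]; exact one_mem _
    | of u g => exact hv u g
    | mul x y hx hy => rw [map_mul]; exact mul_mem hx hy
  | inr n =>
    induction n using FreeGroup.induction_on with
    | C1 => rw [map_one]; exact one_mem _
    | of e => exact he e
    | inv_of e h => rw [map_inv]; exact inv_mem h
    | mul x y hx hy => rw [map_mul]; exact mul_mem hx hy
  | mul x y hx hy => exact mul_mem hx hy

variable {S}

theorem stableLetter_eq_one {e : E} (he : e ∈ S) : G.stableLetter S e = 1 :=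
  (QuotientGroup.eq_one_iff _).2 (Subgroup.subset_normalClosure (.tree e he))

/-! ### Vertex groups embed in the fundamental group -/

/-- `A × Ω` and `H × Ω` are isomorphic as `H`-sets for a subgroup `H` of `A` if the set `Ω` is large
enough: both are free with as many orbits as `Ω` has elements. -/
theorem exists_equivariant_equiv {A H : Type*} [Group A] [Group H] (i : H →* A)
    (hi : Function.Injective i) {Ω : Type*} [Infinite Ω] (ε : A ↪ Ω) :
    ∃ η : A × Ω ≃ H × Ω, ∀ h x, η (i h * x.1, x.2) = (h * (η x).1, (η x).2) := by
  obtain ⟨R, hR, hR1⟩ := i.range.exists_isComplement_right 1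
  obtain ⟨sq⟩ : Nonempty (Ω × Ω ≃ Ω) :=
    Cardinal.eq.1 (by rw [Cardinal.mk_prod, Cardinal.lift_id, Cardinal.mul_eq_self
      (Cardinal.aleph0_le_mk Ω)])
  let j : R × Ω ↪ Ω := ((⟨fun x => ε x.1, fun x y h => Subtype.ext (ε.injective h)⟩ :
    R ↪ Ω).prodMap (.refl Ω)).trans sq.toEmbedding
  obtain ⟨κ⟩ : Nonempty (R × Ω ≃ Ω) := Function.Embedding.antisymm j
    ⟨fun k => (⟨1, hR1⟩, k), fun k l h => (Prod.mk.inj h).2⟩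
  let τ : H ≃* i.range := MonoidHom.ofInjective hi
  refine ⟨(Equiv.prodCongr hR.equiv (.refl Ω)).trans ((Equiv.prodAssoc _ _ _).trans
    (Equiv.prodCongr τ.symm.toEquiv κ)), fun h x => ?_⟩
  have h1 := hR.equiv_mul_left (τ h) x.1
  have h2 : ((τ h : i.range) : A) = i h := rfl
  rw [h2] at h1
  change ((τ.symm (hR.equiv (i h * x.1)).1, κ ((hR.equiv (i h * x.1)).2, x.2)) : H × Ω) =
    (h * τ.symm (hR.equiv x.1).1, κ ((hR.equiv x.1).2, x.2))
  rw [h1, map_mul, MulEquiv.symm_apply_apply]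

/-- The vertex groups act freely on a common infinite set `Ω` in such a way that, for every edge,
the two actions of the edge group are conjugate. This gives an action of the fundamental group
whose restriction to every vertex group is free. -/
theorem vertexHom_injective (hS : G.toOrientedGraph.IsSpanningTree S) (v : V) :
    Function.Injective (G.vertexHom S v) := by
  let Ω := ℕ ⊕ Σ u, G.vertexGroup u
  have hε : ∀ u, Nonempty (G.vertexGroup u ↪ Ω) := fun u =>
    ⟨⟨fun g => .inr ⟨u, g⟩, fun g h hgh =>
      eq_of_heq (Sigma.mk.inj (Sum.inr_injective hgh)).2⟩⟩
  have hθ : ∀ u, Nonempty (G.vertexGroup u × Ω ≃ Ω) := fun u => by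
    obtain ⟨η, -⟩ := exists_equivariant_equiv (1 : PUnit.{1} →* G.vertexGroup u)
      (fun _ _ _ => rfl) (hε u).some
    exact ⟨η.trans (Equiv.punitProd Ω)⟩
  let θ := fun u => (hθ u).some
  let ρ : ∀ u, G.vertexGroup u →* Equiv.Perm Ω := fun u =>
    { toFun := fun g => (θ u).symm.trans
        ((Equiv.prodCongr (Equiv.mulLeft g) (.refl Ω)).trans (θ u))
      map_one' := by ext x; simp
      map_mul' := fun g h => by ext x; simp [mul_assoc]; rfl }
  have hρ : ∀ u g x, ρ u g (θ u x) = θ u (g * x.1, x.2) := fun u g x => by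
    simp [ρ]
    rfl
  choose ηs hηs using fun e => exists_equivariant_equiv (G.srcHom e) (G.srcHom_injective e)
    (hε (G.src e)).some
  choose ηt hηt using fun e => exists_equivariant_equiv (G.tgtHom e) (G.tgtHom_injective e)
    (hε (G.tgt e)).some
  let T : E → Equiv.Perm Ω := fun e =>
    (θ (G.tgt e)).symm.trans ((ηt e).trans ((ηs e).symm.trans (θ (G.src e))))
  have hT : ∀ e a, T e * ρ _ (G.tgtHom e a) = ρ _ (G.srcHom e a) * T e := by
    intro e a
    ext x
    obtain ⟨x, rfl⟩ := (θ (G.tgt e)).surjective x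
    have h1 : ∀ x, T e (θ (G.tgt e) x) = θ (G.src e) ((ηs e).symm (ηt e x)) := fun x => by
      simp [T]
    rw [Equiv.Perm.mul_apply, Equiv.Perm.mul_apply, hρ, h1, h1, hρ, hηt]
    congr 1
    rw [Equiv.symm_apply_eq, hηs]
    simp
  obtain ⟨p, hp⟩ := hS.exists_potential T
  obtain ⟨Φ, hΦ, -⟩ := G.exists_lift S
    (fun u => (MulAut.conj (p u)).toMonoidHom.comp (ρ u))
    (fun e => p (G.src e) * T e * (p (G.tgt e))⁻¹)
    (fun e a => by
      have h1 : ρ _ (G.srcHom e a) = T e * ρ _ (G.tgtHom e a) * (T e)⁻¹ := by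
        rw [hT, mul_inv_cancel_right]
      simp only [MonoidHom.comp_apply, MulEquiv.coe_toMonoidHom, MulAut.conj_apply, h1]
      group)
    (fun e he => by rw [hp e he, mul_inv_cancel])
  rw [injective_iff_map_eq_one]
  intro g hg
  have h1 := hΦ v g
  rw [hg, map_one] at h1
  have h2 : ρ v g = 1 := by
    have h3 : p v * ρ v g * (p v)⁻¹ = 1 := h1.symm
    rwa [conj_eq_one_iff] at h3
  have h3 := hρ v g (1, .inl 0)
  rw [h2, Equiv.Perm.one_apply, (θ v).apply_eq_iff_eq] at h3
  simpa using (Prod.mk.inj h3).1.symm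

/-! ### The Bass-Serre tree is a tree -/

theorem src_mk (e : E) (g : G.FundamentalGroup S) :
    (G.bassSerreTree S).src ⟨e, QuotientGroup.mk g⟩ = ⟨G.src e, QuotientGroup.mk g⟩ := rfl

theorem tgt_mk (e : E) (g : G.FundamentalGroup S) :
    (G.bassSerreTree S).tgt ⟨e, QuotientGroup.mk g⟩ =
      ⟨G.tgt e, QuotientGroup.mk (g * G.stableLetter S e)⟩ := rfl

theorem joined_smul (z : G.FundamentalGroup S) {a b : G.TreeVertex S}
    (h : (G.bassSerreTree S).Joined Set.univ a b) :
    (G.bassSerreTree S).Joined Set.univ (z • a) (z • b) := by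
  induction h with
  | rel a b h =>
    obtain ⟨f, -, rfl, rfl⟩ := h
    rw [← bassSerreTree_src_smul, ← bassSerreTree_tgt_smul]
    exact OrientedGraph.joined_edge trivial
  | refl => exact .refl _
  | symm _ _ _ ih => exact ih.symm
  | trans _ _ _ _ _ ih1 ih2 => exact ih1.trans _ _ _ ih2

/-- The elements which move a given vertex to a vertex in the same component form a subgroup. It
contains the vertex groups and the edges, so the Bass-Serre tree is connected. -/
theorem joined_bassSerreTree (hS : G.toOrientedGraph.IsSpanningTree S) (a b : G.TreeVertex S) :
    (G.bassSerreTree S).Joined Set.univ a b := by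
  let base : V → G.TreeVertex S := fun u => ⟨u, QuotientGroup.mk 1⟩
  have hbase : ∀ u w, (G.bassSerreTree S).Joined Set.univ (base u) (base w) := by
    intro u w
    refine ((hS.joined u w).eq_of
      (fun w => (G.bassSerreTree S).Joined Set.univ (base u) (base w)) fun e he => ?_).mp (.refl _)
    have h1 := OrientedGraph.joined_edge (Γ := G.bassSerreTree S) (S := Set.univ)
      (e := ⟨e, QuotientGroup.mk 1⟩) trivial
    rw [src_mk, tgt_mk, stableLetter_eq_one G he, mul_one] at h1
    exact propext ⟨fun h => h.trans _ _ _ h1, fun h => h.trans _ _ _ h1.symm⟩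
  have main : ∀ u, ∀ z : G.FundamentalGroup S,
      (G.bassSerreTree S).Joined Set.univ (z • base u) (base u) := by
    intro u z
    let N : Subgroup (G.FundamentalGroup S) :=
      { carrier := {z | (G.bassSerreTree S).Joined Set.univ (z • base u) (base u)}
        one_mem' := by
          change (G.bassSerreTree S).Joined _ _ _
          rw [one_smul]
          exact .refl _
        mul_mem' := fun {y z} hy hz => by
          change (G.bassSerreTree S).Joined _ _ _
          rw [mul_smul]
          exact (G.joined_smul y hz).trans _ _ _ hy
        inv_mem' := fun {z} hz => by
          have h1 := G.joined_smul z⁻¹ hz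
          rw [inv_smul_smul] at h1
          exact h1.symm }
    refine G.mem_of_generators S N (fun w g => ?_) (fun e => ?_) z
    · change (G.bassSerreTree S).Joined Set.univ (G.vertexHom S w g • base u) (base u)
      have h1 := G.joined_smul (G.vertexHom S w g) (hbase u w)
      have h2 : G.vertexHom S w g • base w = base w := by
        refine congrArg (Sigma.mk w) (QuotientGroup.eq.2 ⟨g⁻¹, ?_⟩)
        rw [map_inv]
        simp [base]
      rw [h2] at h1
      exact h1.trans _ _ _ (hbase w u)
    · change (G.bassSerreTree S).Joined Set.univ (G.stableLetter S e • base u) (base u)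
      have h1 := G.joined_smul (G.stableLetter S e) (hbase u (G.tgt e))
      have h2 := OrientedGraph.joined_edge (Γ := G.bassSerreTree S) (S := Set.univ)
        (e := ⟨e, QuotientGroup.mk 1⟩) trivial
      rw [src_mk, tgt_mk, one_mul] at h2
      have h3 : G.stableLetter S e • base (G.tgt e) =
          ⟨G.tgt e, QuotientGroup.mk (G.stableLetter S e)⟩ :=
        congrArg (fun x => (⟨G.tgt e, QuotientGroup.mk x⟩ : G.TreeVertex S)) (mul_one _)
      rw [h3] at h1
      exact h1.trans _ _ _ (h2.symm.trans _ _ _ (hbase _ u))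
  have all : ∀ a : G.TreeVertex S, ∀ u, (G.bassSerreTree S).Joined Set.univ a (base u) := by
    rintro ⟨w, c⟩ u
    induction c using QuotientGroup.induction_on with
    | H g =>
      have h1 : g • base w = ⟨w, QuotientGroup.mk g⟩ :=
        congrArg (fun x => (⟨w, QuotientGroup.mk x⟩ : G.TreeVertex S)) (mul_one g)
      rw [← h1]
      exact (main w g).trans _ _ _ (hbase w u)
  exact (all a a.1).trans _ _ _ (all b a.1).symm

open Classical in
/-- For every edge `f` of the Bass-Serre graph there is a function on the vertices whose values at
the two ends of an edge differ for `f` and for no other edge. All these functions together are a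
function `F` with values in the `π₁`-module of functions on the edges, whose differences are the
indicator functions of the edges. On the vertices given by trivial cosets, `F` is a potential on the
spanning tree, and it is extended to all vertices by means of a derivation of the fundamental group,
that is, a homomorphism to the semidirect product which is a section of the projection. -/
theorem exists_edge_potential (hS : G.toOrientedGraph.IsSpanningTree S) :
    ∃ F : G.TreeVertex S → G.TreeEdge S → Multiplicative ℤ, ∀ f f',
      F ((G.bassSerreTree S).tgt f) f' =
        F ((G.bassSerreTree S).src f) f' * if f = f' then Multiplicative.ofAdd 1 else 1 := by
  let M := G.TreeEdge S → Multiplicative ℤ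
  let φ : G.FundamentalGroup S →* MulAut M := mulAutArrow
  have hφ : ∀ g m f, φ g m f = m (g⁻¹ • f) := fun g m f => rfl
  let ind : G.TreeEdge S → M := fun f f' => if f = f' then Multiplicative.ofAdd 1 else 1
  have hind : ∀ g f, φ g (ind f) = ind (g • f) := by
    intro g f
    funext f'
    rw [hφ]
    simp only [ind, eq_inv_smul_iff]
  let base : E → G.TreeEdge S := fun e => ⟨e, QuotientGroup.mk 1⟩
  have hbase : ∀ e a, φ (G.vertexHom S _ (G.srcHom e a)) (ind (base e)) = ind (base e) := by
    intro e a
    rw [hind]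
    congr 1
    refine congrArg (Sigma.mk e) (QuotientGroup.eq.2 ⟨a⁻¹, ?_⟩)
    rw [map_inv]
    simp [base]
  obtain ⟨c, hc⟩ := hS.exists_potential fun e => ind (base e)
  let ci : V → M ⋊[φ] G.FundamentalGroup S := fun u => SemidirectProduct.inl (c u)
  obtain ⟨Φ, hΦv, hΦe⟩ := G.exists_lift S (H := M ⋊[φ] G.FundamentalGroup S)
    (fun u => (MulAut.conj (ci u)).toMonoidHom.comp
      (SemidirectProduct.inr.comp (G.vertexHom S u)))
    (fun e => ci (G.src e) * SemidirectProduct.inl (ind (base e)) *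
      SemidirectProduct.inr (G.stableLetter S e) * (ci (G.tgt e))⁻¹)
    (fun e a => by
      simp only [MonoidHom.comp_apply, MulEquiv.coe_toMonoidHom, MulAut.conj_apply]
      have h1 := SemidirectProduct.inl_aut (φ := φ) (G.vertexHom S _ (G.srcHom e a)) (ind (base e))
      rw [hbase, map_inv, eq_mul_inv_iff_mul_eq] at h1
      have h2 := congrArg (SemidirectProduct.inr (φ := φ)) (G.stableLetter_conj S e a)
      rw [map_mul, map_mul, map_inv] at h2
      calc _ = ci (G.src e) * SemidirectProduct.inl (ind (base e)) *
            (SemidirectProduct.inr (G.stableLetter S e) *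
              SemidirectProduct.inr (G.vertexHom S _ (G.tgtHom e a)) *
              (SemidirectProduct.inr (G.stableLetter S e))⁻¹) *
            (SemidirectProduct.inl (ind (base e)))⁻¹ * (ci (G.src e))⁻¹ := by group
        _ = _ := by
          rw [h2, mul_assoc (ci _), h1]
          group)
    (fun e he => by
      rw [G.stableLetter_eq_one he, map_one, mul_one, mul_inv_eq_one]
      simp only [ci]
      rw [← map_mul, hc e he])
  have hright : ∀ g, (Φ g).right = g := by
    intro g
    refine G.mem_of_generators S
      ((SemidirectProduct.rightHom.comp Φ).eqLocus (MonoidHom.id _)) (fun u g => ?_) (fun e => ?_) g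
    · change (Φ _).right = _
      rw [hΦv]
      simp [ci]
    · change (Φ _).right = _
      rw [hΦe]
      simp [ci]
  have hinv : ∀ u g h, (Φ (g * G.vertexHom S u h) * ci u).left = (Φ g * ci u).left := by
    intro u g h
    have h1 : Φ (g * G.vertexHom S u h) * ci u =
        Φ g * ci u * SemidirectProduct.inr (G.vertexHom S u h) := by
      rw [map_mul, hΦv]
      simp only [MonoidHom.comp_apply, MulEquiv.coe_toMonoidHom, MulAut.conj_apply]
      group
    rw [h1, SemidirectProduct.mul_left, SemidirectProduct.left_inr, map_one, mul_one]
  let F : G.TreeVertex S → M := fun w => (Φ w.2.out * ci w.1).left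
  have hF : ∀ u g, F ⟨u, QuotientGroup.mk g⟩ = (Φ g * ci u).left := by
    intro u g
    obtain ⟨⟨_, h, rfl⟩, hh⟩ := QuotientGroup.mk_out_eq_mul (G.vertexSubgroup S u) g
    change (Φ (QuotientGroup.mk g : _ ⧸ G.vertexSubgroup S u).out * ci u).left = _
    rw [hh]
    exact hinv u g h
  refine ⟨F, ?_⟩
  rintro ⟨e, d⟩ f'
  induction d using QuotientGroup.induction_on with
  | H g =>
    rw [src_mk, tgt_mk, hF, hF]
    have h1 : Φ (g * G.stableLetter S e) * ci (G.tgt e) =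
        Φ g * ci (G.src e) * SemidirectProduct.inl (ind (base e)) *
          SemidirectProduct.inr (G.stableLetter S e) := by
      rw [map_mul, hΦe]
      group
    have h2 : (Φ g * ci (G.src e)).right = g := by
      rw [SemidirectProduct.mul_right, hright]
      simp [ci]
    have h3 : g • base e = ⟨e, QuotientGroup.mk g⟩ :=
      congrArg (fun x => (⟨e, QuotientGroup.mk x⟩ : G.TreeEdge S)) (mul_one g)
    rw [h1, SemidirectProduct.mul_left, SemidirectProduct.left_inr, map_one, mul_one,
      SemidirectProduct.mul_left, h2, SemidirectProduct.left_inl, hind, h3]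
    rfl

theorem isSpanningTree_bassSerreTree (hS : G.toOrientedGraph.IsSpanningTree S) :
    (G.bassSerreTree S).IsSpanningTree Set.univ where
  joined := G.joined_bassSerreTree hS
  bridge f _ h := by
    obtain ⟨F, hF⟩ := G.exists_edge_potential hS
    have h1 := h.eq_of (fun w => F w f) fun f' hf' => by
      rw [hF, if_neg fun h : f' = f => hf'.2 h, mul_one]
    rw [hF, if_pos rfl, left_eq_mul] at h1
    exact absurd (congrArg Multiplicative.toAdd h1) one_ne_zero

end GraphOfGroups

/-! ### Group actions on trees of spaces -/

namespace TreeOfSpaces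

variable {J : Type uV} {K : Type uE} {𝒯 : TreeOfSpaces.{uV, uE, uX} J K}

/-- A group acts on a tree of spaces: it acts on the disjoint union of the spaces, mapping each of
them isometrically into another one, and on the edges, and it respects the attaching points. -/
class CompatibleSMul (H : Type*) [Group H] (𝒯 : TreeOfSpaces.{uV, uE, uX} J K)
    [MulAction H 𝒯.Point] [MulAction H K] : Prop where
  piece : ∀ (h : H) (j : J), ∃ (j' : J) (φ : 𝒯.space j → 𝒯.space j'), Isometry φ ∧
    ∀ x, h • (⟨j, x⟩ : 𝒯.Point) = ⟨j', φ x⟩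
  endPt : ∀ (h : H) (k : K) (b : Bool),
    h • (⟨𝒯.endVertex k b, 𝒯.endPt k b⟩ : 𝒯.Point) = ⟨𝒯.endVertex (h • k) b, 𝒯.endPt (h • k) b⟩

variable {H : Type*} [Group H] [MulAction H 𝒯.Point] [MulAction H K]

/-- A point of the disjoint union of the spaces, before the intervals were inserted. -/
def ofPoint (y : 𝒯.Point) : 𝒯.subdivide.Point := 𝒯.vertexPt y.idx y.val

noncomputable instance : MulAction H 𝒯.subdivide.Point where
  smul h
    | ⟨.inl j, x⟩ => ofPoint (h • (⟨j, x⟩ : 𝒯.Point))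
    | ⟨.inr k, t⟩ => 𝒯.edgePt (h • k) t.down
  one_smul := point_cases (fun j x => congrArg ofPoint (one_smul H (⟨j, x⟩ : 𝒯.Point)))
    (fun k t => congrArg (𝒯.edgePt · t) (one_smul H k))
  mul_smul g h := point_cases (fun j x => congrArg ofPoint (mul_smul g h (⟨j, x⟩ : 𝒯.Point)))
    (fun k t => congrArg (𝒯.edgePt · t) (mul_smul g h k))

theorem smul_ofPoint (h : H) (y : 𝒯.Point) : h • ofPoint y = ofPoint (h • y) := rfl

theorem smul_edgePt (h : H) (k : K) (t : I) : h • 𝒯.edgePt k t = 𝒯.edgePt (h • k) t := rfl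

variable [CompatibleSMul H 𝒯]

theorem edist_smul_le (h : H) (y z : 𝒯.subdivide.Point) : edist (h • y) (h • z) ≤ edist y z := by
  refine le_edist_of_step (δ := fun y z => edist (h • y) (h • z))
    (fun _ => edist_self _) (fun _ _ _ => edist_triangle _ _ _) (fun y z l hs => ?_) y z
  have hend : ∀ k b, edist (h • 𝒯.edgePt k (endParam b)) (h • 𝒯.vertexPt _ (𝒯.endPt k b)) = 0 := by
    intro k b
    have h1 : h • 𝒯.vertexPt _ (𝒯.endPt k b) = 𝒯.vertexPt _ (𝒯.endPt (h • k) b) :=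
      congrArg ofPoint (CompatibleSMul.endPt h k b)
    rw [h1, smul_edgePt, edist_dist, dist_edgePt_end, ENNReal.ofReal_zero]
  obtain ⟨j, x, x', rfl, rfl, rfl⟩ | ⟨k, s, t, rfl, rfl, rfl⟩ | ⟨k, b, rfl, rfl, rfl⟩ |
    ⟨k, b, rfl, rfl, rfl⟩ := step_edgePt_cases hs
  · obtain ⟨j', φ, hφ, hj⟩ := CompatibleSMul.piece (𝒯 := 𝒯) h j
    have h1 : ∀ x, h • 𝒯.vertexPt j x = 𝒯.vertexPt j' (φ x) := fun x => congrArg ofPoint (hj x)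
    rw [h1, h1, edist_dist, dist_vertexPt_self, ← edist_dist, hφ.edist_eq]
  · rw [smul_edgePt, smul_edgePt, edist_dist, dist_edgePt_self, ← edist_dist]
  · exact (hend k b).le
  · rw [edist_comm]
    exact (hend k b).le

instance : IsIsometricSMul H 𝒯.subdivide.Point where
  isometry_smul h y z := by
    refine le_antisymm (edist_smul_le h y z) ?_
    have h1 := edist_smul_le h⁻¹ (h • y) (h • z)
    rwa [inv_smul_smul, inv_smul_smul] at h1

noncomputable instance : MulAction H 𝒯.subdivide.Glued :=
  inferInstanceAs (MulAction H (SeparationQuotient 𝒯.subdivide.Point))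

theorem smul_toGlued (h : H) (y : 𝒯.subdivide.Point) : h • toGlued y = toGlued (h • y) := rfl

instance : IsIsometricSMul H 𝒯.subdivide.Glued where
  isometry_smul h := .of_dist_eq fun y z => by
    obtain ⟨y, rfl⟩ := toGlued_surjective y
    obtain ⟨z, rfl⟩ := toGlued_surjective z
    rw [smul_toGlued, smul_toGlued, dist_toGlued, dist_toGlued, dist_smul]

end TreeOfSpaces

/-! ### The tree of spaces of a graph of groups -/

namespace GraphOfGroups

variable {V : Type uV} {E : Type uE} (G : GraphOfGroups.{uV, uE, uG, uH} V E) {S : Set E}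
/-- The element of the vertex group by which `g` differs from the chosen representative of its
coset. -/
noncomputable def cosetDiff (S : Set E) (u : V) (g : G.FundamentalGroup S) : G.vertexGroup u :=
  Function.invFun (G.vertexHom S u) ((g : G.FundamentalGroup S ⧸ G.vertexSubgroup S u).out⁻¹ * g)

theorem vertexHom_cosetDiff (u : V) (g : G.FundamentalGroup S) :
    G.vertexHom S u (G.cosetDiff S u g) =
      (g : G.FundamentalGroup S ⧸ G.vertexSubgroup S u).out⁻¹ * g := by
  refine Function.invFun_eq (?_ : (_ : G.FundamentalGroup S) ∈ G.vertexSubgroup S u)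
  rw [← QuotientGroup.eq, QuotientGroup.out_eq']

theorem cosetDiff_mul (hS : G.toOrientedGraph.IsSpanningTree S) (u : V)
    (g : G.FundamentalGroup S) (h : G.vertexGroup u) :
    G.cosetDiff S u (g * G.vertexHom S u h) = G.cosetDiff S u g * h := by
  refine G.vertexHom_injective hS u ?_
  have h1 : ((g * G.vertexHom S u h : G.FundamentalGroup S) :
      G.FundamentalGroup S ⧸ G.vertexSubgroup S u) = g :=
    QuotientGroup.mk_mul_of_mem g ⟨h, rfl⟩
  rw [map_mul, vertexHom_cosetDiff, vertexHom_cosetDiff, h1, mul_assoc]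

theorem cosetDiff_out (hS : G.toOrientedGraph.IsSpanningTree S) (u : V)
    (c : G.FundamentalGroup S ⧸ G.vertexSubgroup S u) :
    G.cosetDiff S u c.out = 1 := by
  refine G.vertexHom_injective hS u ?_
  rw [vertexHom_cosetDiff, QuotientGroup.out_eq', inv_mul_cancel, map_one]

variable (hS : G.toOrientedGraph.IsSpanningTree S)
variable (𝒳 : V → Type uX) [∀ u, MetricSpace (𝒳 u)] [∀ u, MulAction (G.vertexGroup u) (𝒳 u)]
variable (ps : ∀ e, 𝒳 (G.src e)) (pt : ∀ e, 𝒳 (G.tgt e))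

/-- The tree of spaces over the Bass-Serre tree with a copy of `𝒳 u` over every lift of `u`. The
copy over a coset is to be thought of as the part over this coset of the induced space
`π₁(G) ×_{G_u} 𝒳 u`, identified with `𝒳 u` through the chosen representative of the coset. -/
noncomputable def treeOfSpaces : TreeOfSpaces (G.TreeVertex S) (G.TreeEdge S) where
  toOrientedGraph := G.bassSerreTree S
  isTree := G.isSpanningTree_bassSerreTree hS
  space w := 𝒳 w.1
  srcPt f := G.cosetDiff S (G.src f.1) f.2.out • ps f.1
  tgtPt f := G.cosetDiff S (G.tgt f.1) (f.2.out * G.stableLetter S f.1) • pt f.1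

/-- The point `[g, x]` of the induced space `π₁(G) ×_{G_u} 𝒳 u`. -/
noncomputable def inducedPt (u : V) (g : G.FundamentalGroup S) (x : 𝒳 u) :
    (G.treeOfSpaces hS 𝒳 ps pt).Point :=
  ⟨⟨u, QuotientGroup.mk g⟩, (G.cosetDiff S u g • x : 𝒳 u)⟩

theorem inducedPt_mul (u : V) (g : G.FundamentalGroup S) (h : G.vertexGroup u) (x : 𝒳 u) :
    G.inducedPt hS 𝒳 ps pt u (g * G.vertexHom S u h) x = G.inducedPt hS 𝒳 ps pt u g (h • x) := by
  have h1 : ((g * G.vertexHom S u h : G.FundamentalGroup S) :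
      G.FundamentalGroup S ⧸ G.vertexSubgroup S u) = g :=
    QuotientGroup.mk_mul_of_mem g ⟨h, rfl⟩
  rw [inducedPt, inducedPt, cosetDiff_mul G hS, mul_smul, h1]

theorem inducedPt_out (u : V) (c : G.FundamentalGroup S ⧸ G.vertexSubgroup S u) (x : 𝒳 u) :
    G.inducedPt hS 𝒳 ps pt u c.out x = ⟨⟨u, c⟩, x⟩ := by
  rw [inducedPt, cosetDiff_out G hS, one_smul, QuotientGroup.out_eq']

theorem inducedPt_cases {P : (G.treeOfSpaces hS 𝒳 ps pt).Point → Prop}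
    (h : ∀ u g x, P (G.inducedPt hS 𝒳 ps pt u g x)) : ∀ y, P y
  | ⟨⟨u, c⟩, x⟩ => (congrArg P (G.inducedPt_out hS 𝒳 ps pt u c x)).mp (h u c.out x)

/-- The action `z • [g, x] = [z g, x]`. -/
noncomputable instance : SMul (G.FundamentalGroup S) (G.treeOfSpaces hS 𝒳 ps pt).Point where
  smul z y := G.inducedPt hS 𝒳 ps pt y.idx.1 (z * y.idx.2.out) y.val

theorem smul_inducedPt (z : G.FundamentalGroup S) (u : V) (g : G.FundamentalGroup S) (x : 𝒳 u) :
    z • G.inducedPt hS 𝒳 ps pt u g x = G.inducedPt hS 𝒳 ps pt u (z * g) x := by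
  change G.inducedPt hS 𝒳 ps pt u (z * (g : G.FundamentalGroup S ⧸ G.vertexSubgroup S u).out)
    (G.cosetDiff S u g • x) = _
  rw [← inducedPt_mul, vertexHom_cosetDiff]
  congr 1
  group

noncomputable instance : MulAction (G.FundamentalGroup S) (G.treeOfSpaces hS 𝒳 ps pt).Point where
  one_smul := G.inducedPt_cases hS 𝒳 ps pt fun u g x => by rw [smul_inducedPt, one_mul]
  mul_smul y z := G.inducedPt_cases hS 𝒳 ps pt fun u g x => by
    rw [smul_inducedPt, smul_inducedPt, smul_inducedPt, mul_assoc]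

/-- If the attaching points are fixed by the edge groups, then the fundamental group acts on the
tree of spaces. -/
theorem compatibleSMul [∀ u, IsIsometricSMul (G.vertexGroup u) (𝒳 u)]
    (hsrc : ∀ e a, G.srcHom e a • ps e = ps e)
    (htgt : ∀ e a, G.tgtHom e a • pt e = pt e) :
    TreeOfSpaces.CompatibleSMul (G.FundamentalGroup S) (G.treeOfSpaces hS 𝒳 ps pt) where
  piece z w := ⟨⟨w.1, QuotientGroup.mk (z * w.2.out)⟩,
    fun x : 𝒳 w.1 => (G.cosetDiff S w.1 (z * w.2.out) • x : 𝒳 w.1),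
    isometry_smul (𝒳 w.1) (G.cosetDiff S w.1 (z * w.2.out)), fun _ => rfl⟩
  endPt := by
    have h0 : ∀ e (g : G.FundamentalGroup S),
        (⟨_, (G.treeOfSpaces hS 𝒳 ps pt).endPt ⟨e, QuotientGroup.mk g⟩ false⟩ :
          (G.treeOfSpaces hS 𝒳 ps pt).Point) = G.inducedPt hS 𝒳 ps pt (G.src e) g (ps e) := by
      intro e g
      obtain ⟨⟨_, a, rfl⟩, ha⟩ := QuotientGroup.mk_out_eq_mul (G.edgeSubgroup S e) g
      change (⟨⟨G.src e, QuotientGroup.mk g⟩, G.cosetDiff S (G.src e)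
        (QuotientGroup.mk g : _ ⧸ G.edgeSubgroup S e).out • ps e⟩ :
          (G.treeOfSpaces hS 𝒳 ps pt).Point) = _
      rw [ha]
      change (⟨⟨G.src e, QuotientGroup.mk g⟩, G.cosetDiff S (G.src e)
        (g * G.vertexHom S (G.src e) (G.srcHom e a)) • ps e⟩ :
          (G.treeOfSpaces hS 𝒳 ps pt).Point) = _
      rw [cosetDiff_mul G hS, mul_smul]
      erw [hsrc]
      rfl
    have h1 : ∀ e (g : G.FundamentalGroup S),
        (⟨_, (G.treeOfSpaces hS 𝒳 ps pt).endPt ⟨e, QuotientGroup.mk g⟩ true⟩ :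
          (G.treeOfSpaces hS 𝒳 ps pt).Point) =
        G.inducedPt hS 𝒳 ps pt (G.tgt e) (g * G.stableLetter S e) (pt e) := by
      intro e g
      obtain ⟨⟨_, a, rfl⟩, ha⟩ := QuotientGroup.mk_out_eq_mul (G.edgeSubgroup S e) g
      change (⟨⟨G.tgt e, QuotientGroup.mk (g * G.stableLetter S e)⟩, G.cosetDiff S (G.tgt e)
        ((QuotientGroup.mk g : _ ⧸ G.edgeSubgroup S e).out * G.stableLetter S e) • pt e⟩ :
          (G.treeOfSpaces hS 𝒳 ps pt).Point) = _
      have h2 : (QuotientGroup.mk g : _ ⧸ G.edgeSubgroup S e).out * G.stableLetter S e =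
          g * G.stableLetter S e * G.vertexHom S (G.tgt e) (G.tgtHom e a) := by
        rw [ha]
        change g * G.vertexHom S _ (G.srcHom e a) * _ = _
        rw [← G.stableLetter_conj S e a]
        group
      rw [h2, cosetDiff_mul G hS, mul_smul]
      erw [htgt]
      rfl
    rintro z ⟨e, c⟩ b
    induction c using QuotientGroup.induction_on with
    | H g =>
      cases b
      · exact (congrArg (z • ·) (h0 e g)).trans ((G.smul_inducedPt hS 𝒳 ps pt z _ g _).trans
          (h0 e (z * g)).symm)
      · refine (congrArg (z • ·) (h1 e g)).trans ((G.smul_inducedPt hS 𝒳 ps pt z _ _ _).trans ?_)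
        rw [← mul_assoc]
        exact (h1 e (z * g)).symm

/-- The map from the glued space to the Bass-Serre tree which collapses the vertex spaces. -/
noncomputable def toBassSerreTree (y : (G.treeOfSpaces hS 𝒳 ps pt).subdivide.Glued) :
    (G.bassSerreTree S).Realization :=
  (G.treeOfSpaces hS 𝒳 ps pt).toReal y

theorem toBassSerreTree_smul
    [TreeOfSpaces.CompatibleSMul (G.FundamentalGroup S) (G.treeOfSpaces hS 𝒳 ps pt)]
    (z : G.FundamentalGroup S) (y : (G.treeOfSpaces hS 𝒳 ps pt).subdivide.Glued) :
    G.toBassSerreTree hS 𝒳 ps pt (z • y) = z • G.toBassSerreTree hS 𝒳 ps pt y := by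
  obtain ⟨y, rfl⟩ := TreeOfSpaces.toGlued_surjective y
  rw [TreeOfSpaces.smul_toGlued, toBassSerreTree, toBassSerreTree, TreeOfSpaces.toReal_toGlued,
    TreeOfSpaces.toReal_toGlued]
  let q : (G.treeOfSpaces hS 𝒳 ps pt).subdivide.Point → (G.bassSerreTree S).Realization :=
    (G.treeOfSpaces hS 𝒳 ps pt).pointToReal
  refine TreeOfSpaces.point_cases (P := fun y => q (z • y) = z • q y)
    (fun w x => ?_) (fun f t => rfl) y
  obtain ⟨u, c⟩ := w
  have h1 : (⟨u, QuotientGroup.mk (z * c.out)⟩ : G.TreeVertex S) = z • ⟨u, c⟩ := by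
    refine congrArg (Sigma.mk u) ?_
    rw [← smul_eq_mul, MulAction.Quotient.mk_smul_out]
  exact congrArg (G.bassSerreTree S).vertexPoint h1

end GraphOfGroups

/-! ### Vertex spaces concentrated at one vertex -/

/-- The family of spaces which is `X` at the vertex `v` and a single point at every other vertex:
the functions to `X` on the set which has one element if `u = v` and none otherwise. -/
def AtVertex {V : Type uV} (v : V) (X : Type uX) (u : V) : Type (max uH uX) :=
  ULift.{uH} (PLift (u = v)) → X

namespace AtVertex

variable {V : Type uV} {v : V} {X : Type uX}

/-- A point of `X` as a point of the space at `v`. -/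
def const (x : X) : AtVertex.{uV, uH} v X v := fun _ => x

theorem const_surjective : Function.Surjective (const.{uV, uH} : X → AtVertex v X v) :=
  fun y => ⟨y ⟨⟨rfl⟩⟩, funext fun ⟨⟨_⟩⟩ => rfl⟩

theorem subsingleton {u : V} (h : u ≠ v) : Subsingleton (AtVertex.{uV, uH} v X u) :=
  ⟨fun _ _ => funext fun ⟨⟨h'⟩⟩ => absurd h' h⟩

instance [Nonempty X] (u : V) : Nonempty (AtVertex.{uV, uH} v X u) :=
  ⟨fun _ => Classical.arbitrary X⟩

open Classical in
noncomputable instance [MetricSpace X] (u : V) : MetricSpace (AtVertex.{uV, uH} v X u) :=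
  inferInstanceAs (MetricSpace (ULift.{uH} (PLift (u = v)) → X))

instance [MetricSpace X] [CompleteSpace X] (u : V) : CompleteSpace (AtVertex.{uV, uH} v X u) :=
  inferInstanceAs (CompleteSpace (ULift.{uH} (PLift (u = v)) → X))

open Classical in
theorem isometry_const [MetricSpace X] : Isometry (const.{uV, uH} : X → AtVertex v X v) :=
  have : Nonempty (ULift.{uH} (PLift (v = v))) := ⟨⟨⟨rfl⟩⟩⟩
  .of_dist_eq fun x y => dist_pi_const x y

theorem isCAT0 [MetricSpace X] (hX : IsCAT0 X) (u : V) : IsCAT0 (AtVertex.{uV, uH} v X u) := by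
  by_cases h : u = v
  · subst h
    exact hX.of_isometry isometry_const const_surjective
  · have := subsingleton.{uV, uH} (X := X) h
    exact .of_subsingleton

variable {Gr : V → Type uG} [∀ u, Group (Gr u)] [MulAction (Gr v) X]

instance (u : V) : MulAction (Gr u) (AtVertex.{uV, uH} v X u) where
  smul g y := fun h => (h.down.down ▸ g : Gr v) • y h
  one_smul y := funext fun ⟨⟨h⟩⟩ => by subst h; exact one_smul _ _
  mul_smul g g' y := funext fun ⟨⟨h⟩⟩ => by subst h; exact mul_smul _ _ _

theorem smul_const (g : Gr v) (x : X) :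
    g • (const x : AtVertex.{uV, uH} v X v) = const (g • x) := rfl

instance [MetricSpace X] [IsIsometricSMul (Gr v) X] (u : V) :
    IsIsometricSMul (Gr u) (AtVertex.{uV, uH} v X u) where
  isometry_smul g := .of_dist_eq fun x y => by
    by_cases h : u = v
    · subst h
      obtain ⟨x, rfl⟩ := const_surjective x
      obtain ⟨y, rfl⟩ := const_surjective y
      rw [smul_const, smul_const, isometry_const.dist_eq, isometry_const.dist_eq, dist_smul]
    · have := subsingleton.{uV, uH} (X := X) h
      rw [Subsingleton.elim (g • x) x, Subsingleton.elim (g • y) y]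

end AtVertex

/-! ### The blow-up of the Bass-Serre tree -/

theorem mainTheorem5 {V : Type uV} {E : Type uE} (G : GraphOfGroups.{uV, uE, uG, uH} V E)
    (hfin : ∀ e, Finite (G.edgeGroup e))
    (S : Set E) (hS : G.toOrientedGraph.IsSpanningTree S)
    (v : V)
    (X : Type uX) [MetricSpace X] [Nonempty X] [CompleteSpace X] (hX : IsCAT0 X)
    [MulAction (G.vertexGroup v) X] [IsIsometricSMul (G.vertexGroup v) X] :
    ∃ (Y : Type (max uV uE uG uH uX)) (_ : MetricSpace Y)
      (_ : MulAction (G.FundamentalGroup S) Y),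
      CompleteSpace Y ∧ IsCAT0 Y ∧ IsIsometricSMul (G.FundamentalGroup S) Y ∧
      ∃ (emb : G.FundamentalGroup S ⧸ G.vertexSubgroup S v → X → Y)
        (Φ : Collapse (fun u => Set.range (emb u)) ≃ᵢ (G.bassSerreTree S).Realization),
        -- `Y` is obtained by blowing up each lift `u` of `v` by a copy `X_u` of `X`
        IsBlowUp (G.liftPoint S v) emb Φ ∧
        -- at the vertex `w` given by the trivial coset, the vertex group acts by the given action
        (∀ (g : G.vertexGroup v) (x : X),
          G.vertexHom S v g • emb (QuotientGroup.mk 1) x = emb (QuotientGroup.mk 1) (g • x)) ∧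
        -- the copies are permuted, and collapsing them gives the tree equivariantly
        (∀ (z : G.FundamentalGroup S) (u : G.FundamentalGroup S ⧸ G.vertexSubgroup S v),
          (fun y => z • y) '' Set.range (emb u) = Set.range (emb (z • u))) ∧
        (∀ (z : G.FundamentalGroup S) (y : Y),
          Φ (Collapse.mk _ (z • y)) = z • Φ (Collapse.mk _ y)) := by
  classical
  let 𝒳 : V → Type (max uH uX) := AtVertex.{uV, uH, uX} v X
  have hfix : ∀ (u : V) (H : Type uH) [Group H] [Finite H] (φ : H →* G.vertexGroup u),
      ∃ x : 𝒳 u, ∀ h, φ h • x = x := fun u H _ _ φ =>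
    (AtVertex.isCAT0 hX u).exists_fixedPoint ((MulAction.toPermHom (G.vertexGroup u) (𝒳 u)).comp φ)
      fun h x y => dist_smul (φ h) x y
  choose ps hps using fun e => hfix (G.src e) (G.edgeGroup e) (G.srcHom e)
  choose pt hpt using fun e => hfix (G.tgt e) (G.edgeGroup e) (G.tgtHom e)
  let 𝒯 := G.treeOfSpaces hS 𝒳 ps pt
  have hcompat : TreeOfSpaces.CompatibleSMul (G.FundamentalGroup S) 𝒯 :=
    G.compatibleSMul hS 𝒳 ps pt hps hpt
  have hcomplete : ∀ w, CompleteSpace (𝒯.space w) := fun w =>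
    inferInstanceAs (CompleteSpace (AtVertex.{uV, uH, uX} v X w.1))
  -- the copies of `X` are parametrised so that over the trivial coset the point `x` becomes `[1, x]`
  let emb : G.FundamentalGroup S ⧸ G.vertexSubgroup S v → X → 𝒯.subdivide.Glued := fun c x =>
    𝒯.vertexIncl ⟨v, c⟩ (G.cosetDiff S v 1 • (AtVertex.const x : 𝒳 v) : 𝒳 v)
  have hemb1 : ∀ x, emb (QuotientGroup.mk 1) x =
      TreeOfSpaces.toGlued (TreeOfSpaces.ofPoint (G.inducedPt hS 𝒳 ps pt v 1 (AtVertex.const x))) :=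
    fun x => rfl
  have hrange : ∀ c, Set.range (emb c) = Set.range (𝒯.vertexIncl ⟨v, c⟩) := by
    intro c
    refine (Function.Surjective.range_comp (f := fun x : X =>
      (G.cosetDiff S v 1 • (AtVertex.const x : 𝒳 v) : 𝒳 v)) ?_ (𝒯.vertexIncl ⟨v, c⟩))
    exact (MulAction.surjective (G.cosetDiff S v 1)).comp AtVertex.const_surjective
  have hsmul : ∀ (z : G.FundamentalGroup S) c,
      (fun y => z • y) '' Set.range (emb c) ⊆ Set.range (emb (z • c)) := by
    rintro z c _ ⟨_, ⟨x, rfl⟩, rfl⟩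
    rw [hrange, ← MulAction.Quotient.mk_smul_out]
    exact ⟨_, rfl⟩
  obtain ⟨Φ, hΦ⟩ : ∃ Φ : Collapse (fun c => Set.range (emb c)) ≃ᵢ (G.bassSerreTree S).Realization,
      ∀ y, Φ (Collapse.mk _ y) = G.toBassSerreTree hS 𝒳 ps pt y :=
    𝒯.exists_collapse_isometryEquiv (fun c => ⟨v, c⟩)
    (fun c => Set.range (emb c)) hrange
    (fun w => inferInstanceAs (Nonempty (AtVertex.{uV, uH, uX} v X w.1)))
    (fun w hw => AtVertex.subsingleton fun h => hw (by
      obtain ⟨u, c⟩ := w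
      obtain rfl : u = v := h
      exact ⟨c, rfl⟩))
  refine ⟨𝒯.subdivide.Glued, inferInstance, inferInstance, TreeOfSpaces.completeSpace_glued,
    TreeOfSpaces.isCAT0_subdivide fun w => AtVertex.isCAT0 hX w.1, inferInstance, emb, Φ,
    ⟨fun c => ?_, fun c x => ?_⟩, fun g x => ?_, fun z c => ?_, fun z y => ?_⟩
  · exact (TreeOfSpaces.isometry_vertexIncl _).comp
      ((isometry_smul (𝒳 v) (G.cosetDiff S v 1)).comp AtVertex.isometry_const)
  · rw [hΦ]
    exact TreeOfSpaces.toReal_toGlued _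
  · rw [hemb1, hemb1, ← AtVertex.smul_const, ← G.inducedPt_mul hS 𝒳 ps pt,
      TreeOfSpaces.smul_toGlued, TreeOfSpaces.smul_ofPoint, G.smul_inducedPt, one_mul, mul_one]
  · refine (hsmul z c).antisymm fun y hy => ⟨z⁻¹ • y, ?_, smul_inv_smul z y⟩
    have h1 := hsmul z⁻¹ (z • c) ⟨y, hy, rfl⟩
    rwa [inv_smul_smul] at h1
  · rw [hΦ, hΦ]
    exact G.toBassSerreTree_smul hS 𝒳 ps pt z y
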